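/- **Theorem 4.** Let $m\ge 1$ and $\mathbb T^m=\mathbb R^m/2\pi\mathbb Z^m$. For an integrable function $f$ on $\mathbb T^m$ put $\widehat f(k)=(2\pi)^{-m}\int_{\mathbb T^m}f(t)e^{-i(k,t)}\,dt$, $k\in\mathbb Z^m$. For $1<p\le 2$ let $A_p(\mathbb T^m)$ be the space of integrable $f$ with $\widehat f\in l^p(\mathbb Z^m)$, and let $A(\mathbb T^m)=A_1(\mathbb T^m)$ be the space of continuous $f$ with $\widehat f\in l^1(\mathbb Z^m)$; put $\|f\|_{A_p(\mathbb T^m)}=\big(\sum_{k\in\mathbb Z^m}|\widehat f(k)|^p\big)^{1/p}$. For an integer $\nu\ge 0$ and $0<\alpha\le 1$ let $C^{\nu,\alpha}(\mathbb T^m)$ be the class of $\nu$ times differentiable functions on $\mathbb T^m$ all of whose partial derivatives of order $\nu$ have modulus of continuity $O(\delta^\alpha)$ as $\delta\to+0$, and let $C^{\nu,0}(\mathbb T^m)=C^\nu(\mathbb T^m)$. Let $0\le\alpha\le 1$, let $\nu\ge 0$ be an integer with $\nu+\alpha\ge 2$, and let $\varphi\in C^{\nu,\alpha}(\mathbb T^m)$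 be a real function whose gradient is nondegenerate, i.e. the set $\nabla\varphi(\mathbb T^m)\subseteq\mathbb R^m$ has positive Lebesgue measure. Then for every $p$ with $1\le p<2$ and $\nu+\alpha>m(1/p-1/2)$, $$\|e^{i\lambda\varphi}\|_{A_p(\mathbb T^m)}\simeq|\lambda|^{m(1/p-1/2)},\qquad |\lambda|\to\infty,\ \lambda\in\mathbb R,$$ that is, there are constants $c_1,c_2>0$ independent of $\lambda$ such that for all real $\lambda$ with $|\lambda|$ sufficiently large, $e^{i\lambda\varphi}\in A_p(\mathbb T^m)$ and $c_1|\lambda|^{m(1/p-1/2)}\le\|e^{i\lambda\varphi}\|_{A_p(\mathbb T^m)}\le c_2|\lambda|^{m(1/p-1/2)}$. In particular, if $\nu+\alpha>m/2$, then $\|e^{i\lambda\varphi}\|_{A(\mathbb T^m)}\simeq|\lambda|^{m/2}$. -/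

import Mathlib

open MeasureTheory

namespace TorusA

/-- A function on the torus `ℝᵐ / 2πℤᵐ`, viewed as a function on `ℝᵐ` that is `2π`-periodic with
respect to each variable. -/
def IsPeriodic {m : ℕ} {F : Type*} (f : EuclideanSpace ℝ (Fin m) → F) : Prop :=
  ∀ (j : Fin m) (t : EuclideanSpace ℝ (Fin m)),
    f (t + EuclideanSpace.single j (2 * Real.pi)) = f t

/-- The partial derivative `∂^ν f / ∂t_{J 0} ⋯ ∂t_{J (ν-1)}` of order `ν`
(used for `ν` times continuously differentiable `f`; for `ν = 0` it is `f` itself). -/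
noncomputable def partialDeriv {m : ℕ} {F : Type*} [NormedAddCommGroup F] [NormedSpace ℝ F]
    (ν : ℕ) (J : Fin ν → Fin m) (f : EuclideanSpace ℝ (Fin m) → F) :
    EuclideanSpace ℝ (Fin m) → F :=
  fun t => iteratedFDeriv ℝ ν f t (fun i => EuclideanSpace.single (J i) (1 : ℝ))

/-- The Lipschitz condition of order `α`: the modulus of continuity `ω(g, δ)` of `g` satisfies
`ω(g, δ) = O(δ ^ α)` as `δ → 0+`. -/
def LipschitzOrder {m : ℕ} {F : Type*} [NormedAddCommGroup F]
    (α : ℝ) (g : EuclideanSpace ℝ (Fin m) → F) : Prop :=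
  ∃ C δ₀ : ℝ, 0 < δ₀ ∧ ∀ δ : ℝ, 0 < δ → δ ≤ δ₀ →
    ∀ t₁ t₂ : EuclideanSpace ℝ (Fin m), ‖t₁ - t₂‖ ≤ δ → ‖g t₁ - g t₂‖ ≤ C * δ ^ α

/-- The class `C^{ν,α}(𝕋ᵐ)`, `0 ≤ α ≤ 1`, with `C^{ν,0} = C^ν`. -/
def MemC {m : ℕ} {F : Type*} [NormedAddCommGroup F] [NormedSpace ℝ F]
    (ν : ℕ) (α : ℝ) (f : EuclideanSpace ℝ (Fin m) → F) : Prop :=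
  IsPeriodic f ∧ ContDiff ℝ ν f ∧
    (0 < α → ∀ J : Fin ν → Fin m, LipschitzOrder α (partialDeriv ν J f))

/-- The gradient of `φ` is nondegenerate: its range has positive Lebesgue measure. -/
def NondegenerateGradient {m : ℕ} (φ : EuclideanSpace ℝ (Fin m) → ℝ) : Prop :=
  0 < volume (Set.range (gradient φ))

/-- The cube `[0, 2π]ᵐ`. -/
def cube (m : ℕ) : Set (EuclideanSpace ℝ (Fin m)) :=
  {t | ∀ j, t j ∈ Set.Icc (0 : ℝ) (2 * Real.pi)}

/-- The Fourier coefficient `f̂(k) = (2π)⁻ᵐ ∫_{𝕋ᵐ} f(t) e^{-i(k,t)} dt`, `k ∈ ℤᵐ`. -/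
noncomputable def fourierCoefficient {m : ℕ} (f : EuclideanSpace ℝ (Fin m) → ℂ)
    (k : Fin m → ℤ) : ℂ :=
  (1 / (2 * Real.pi : ℂ) ^ m) *
    ∫ t in cube m, f t * Complex.exp (-Complex.I * ((∑ j, (k j : ℝ) * t j : ℝ) : ℂ))

/-- The space `A_p(𝕋ᵐ)`: integrable functions (continuous ones if `p = 1`) whose Fourier
coefficients form a sequence in `l^p(ℤᵐ)`. -/
def MemA {m : ℕ} (p : ℝ) (f : EuclideanSpace ℝ (Fin m) → ℂ) : Prop :=
  IsPeriodic f ∧ IntegrableOn f (cube m) ∧ (p = 1 → Continuous f) ∧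
    Summable (fun k : Fin m → ℤ => ‖fourierCoefficient f k‖ ^ p)

/-- The norm of `A_p(𝕋ᵐ)` (meaningful on members of `A_p(𝕋ᵐ)`). -/
noncomputable def normA {m : ℕ} (p : ℝ) (f : EuclideanSpace ℝ (Fin m) → ℂ) : ℝ :=
  (∑' k : Fin m → ℤ, ‖fourierCoefficient f k‖ ^ p) ^ (1 / p)

/-- The function `e^{iλφ}`. -/
noncomputable def expPhase {m : ℕ} (φ : EuclideanSpace ℝ (Fin m) → ℝ) (lam : ℝ) :
    EuclideanSpace ℝ (Fin m) → ℂ :=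
  fun t => Complex.exp (Complex.I * ((lam * φ t : ℝ) : ℂ))

end TorusA

/-! Write f = e^{iλφ}, s = ν + α and β = m(1 - p/2). Both bounds are proved for the sum of
|f̂(k)|^p, which is to be of order |λ|^β; the norm is its p-th root.

Upper bound. Take an integer R with |λ| ≤ R ≤ 2|λ|. On the scale 1/R the phase λφ, restricted to a
coordinate line, has derivatives of orders 1, ..., ν bounded uniformly in λ, the last one uniformly
α-Hölder. Hence the difference of f of order ν + 1 with step h/R in a coordinate direction is O(h^s)
(`exists_norm_iterate_fwdDiff_expPhase_le`). On the Fourier side this difference multiplies f̂(k) by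
(e^{i k_j h/R} - 1)^{ν+1}, which is bounded below when |k_j| h/R lies in [1, 2]. With h = 2^{-n},
Bessel's inequality gives O(2^{-2ns}) for the sum of |f̂(k)|² over the shell R 2^n < max |k_j| ≤ R
2^{n+1} (`sum_sq_sdiff_box_le`). The shell has O((R 2^n)^m) points, so Hölder's inequality bounds
its ℓ^p sum by a multiple of R^β 2^{n(β - sp)}. This is a convergent geometric series because s >
m(1/p - 1/2). In the central box Bessel's and Hölder's inequalities alone suffice.

Lower bound. The gradient is Lipschitz because s ≥ 2. If k is within 1 of λ∇φ(t₀) in each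
coordinate, then f(t) e^{-i(k,t)} is nearly constant within a distance of order |λ|^{-1/2} from t₀
(`norm_expPhase_mul_character_sub_le`). Testing it against a nonnegative trigonometric polynomial of
that width gives an integral of size at least a constant times |λ|^{-m/2}
(`half_le_norm_setIntegral_window_mul`). The window is a convex combination of characters, so this
integral is bounded by (2π)^m times a weighted mean of the |f̂(k - n_i)|. The set λ∇φ(𝕋^m) has
measure of order |λ|^m, which supplies at least a constant times |λ|^m such k
(`exists_finset_floor_gradient`). Jensen's inequality and summation over these k give at least a
constant times |λ|^m · |λ|^{-mp/2} = |λ|^β. -/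

namespace TorusA

variable {m : ℕ}

/-! ### Characters, integration over the cube, and Bessel's inequality -/

/-- The character `t ↦ e^{i(k,t)}`. -/
noncomputable def character (k : Fin m → ℤ) (t : EuclideanSpace ℝ (Fin m)) : ℂ :=
  Complex.exp (((∑ j, (k j : ℝ) * t j : ℝ) : ℂ) * Complex.I)

theorem fourierCoefficient_eq (f : EuclideanSpace ℝ (Fin m) → ℂ) (k : Fin m → ℤ) :
    fourierCoefficient f k =
      (1 / (2 * Real.pi : ℂ) ^ m) * ∫ t in cube m, f t * character (-k) t := by
  unfold fourierCoefficient character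
  congr 2
  ext t
  congr 2
  push_cast
  simp only [Pi.neg_apply, Int.cast_neg, neg_mul, Finset.sum_neg_distrib]
  ring

theorem norm_character (k : Fin m → ℤ) (t : EuclideanSpace ℝ (Fin m)) :
    ‖character k t‖ = 1 := Complex.norm_exp_ofReal_mul_I _

theorem continuous_character (k : Fin m → ℤ) : Continuous (character k) := by
  unfold character
  fun_prop

theorem character_add (k l : Fin m → ℤ) (t : EuclideanSpace ℝ (Fin m)) :
    character (k + l) t = character k t * character l t := by
  unfold character
  rw [← Complex.exp_add, ← add_mul, ← Complex.ofReal_add, ← Finset.sum_add_distrib]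
  simp [add_mul]

theorem character_add_right (k : Fin m → ℤ) (t u : EuclideanSpace ℝ (Fin m)) :
    character k (t + u) = character k t * character k u := by
  unfold character
  rw [← Complex.exp_add, ← add_mul, ← Complex.ofReal_add, ← Finset.sum_add_distrib]
  simp [mul_add]

theorem character_zero (t : EuclideanSpace ℝ (Fin m)) : character 0 t = 1 := by
  simp [character]

theorem character_single (k : Fin m → ℤ) (j : Fin m) (h : ℝ) :
    character k (EuclideanSpace.single j h) = Complex.exp ((((k j : ℝ) * h : ℝ) : ℂ) * Complex.I) := by
  unfold character
  congr 3
  rw [Finset.sum_eq_single j]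
  · simp
  · intro b _ hb
    simp [hb]
  · simp

theorem isPeriodic_character (k : Fin m → ℤ) : IsPeriodic (character k) := by
  intro j t
  rw [character_add_right, character_single]
  have : (((k j : ℝ) * (2 * Real.pi) : ℝ) : ℂ) * Complex.I
      = (k j : ℂ) * (2 * Real.pi * Complex.I) := by
    push_cast; ring
  rw [this, Complex.exp_int_mul_two_pi_mul_I, mul_one]

theorem character_eq_prod (k : Fin m → ℤ) (t : EuclideanSpace ℝ (Fin m)) :
    character k t = ∏ j, Complex.exp (((k j : ℝ) * t j : ℝ) * Complex.I) := by
  unfold character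
  rw [← Complex.exp_sum, ← Finset.sum_mul]
  push_cast
  rfl

theorem IsPeriodic.mul {f g : EuclideanSpace ℝ (Fin m) → ℂ} (hf : IsPeriodic f)
    (hg : IsPeriodic g) : IsPeriodic (fun t => f t * g t) := fun j t => by
  simp only [hf j t, hg j t]

theorem isCompact_cube : IsCompact (cube m) := by
  have : cube m = (EuclideanSpace.equiv (Fin m) ℝ).toHomeomorph.symm ''
      (Set.pi Set.univ fun _ => Set.Icc (0 : ℝ) (2 * Real.pi)) := by
    ext t
    rw [← Homeomorph.preimage_symm]
    simp only [cube, Homeomorph.symm_symm, Set.mem_preimage, Set.mem_univ_pi]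
    rfl
  rw [this]
  exact (isCompact_univ_pi fun _ => isCompact_Icc).image
    (EuclideanSpace.equiv (Fin m) ℝ).toHomeomorph.symm.continuous

theorem integrableOn_cube {F : Type*} [NormedAddCommGroup F] {f : EuclideanSpace ℝ (Fin m) → F}
    (hf : Continuous f) : IntegrableOn f (cube m) :=
  hf.continuousOn.integrableOn_compact isCompact_cube

theorem setIntegral_cube_eq {F : Type*} [NormedAddCommGroup F] [NormedSpace ℝ F]
    (f : EuclideanSpace ℝ (Fin m) → F) :
    ∫ t in cube m, f t =
      ∫ x, f (WithLp.toLp 2 x)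
        ∂(Measure.pi fun _ : Fin m => (volume : Measure ℝ).restrict (Set.Icc 0 (2 * Real.pi))) := by
  rw [← Measure.restrict_pi_pi, ← volume_pi]
  have h := (PiLp.volume_preserving_toLp (Fin m)).setIntegral_preimage_emb
    (MeasurableEquiv.toLp 2 (Fin m → ℝ)).measurableEmbedding f (cube m)
  rw [← h]
  congr 2
  ext x
  simp only [cube, Set.mem_preimage, Set.mem_univ_pi]
  rfl

theorem setIntegral_cube_prod {𝕜 : Type*} [RCLike 𝕜] (g : Fin m → ℝ → 𝕜) :
    ∫ t in cube m, ∏ j, g j (t j) = ∏ j, ∫ x in Set.Icc 0 (2 * Real.pi), g j x := by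
  rw [setIntegral_cube_eq]
  exact integral_fintype_prod_eq_prod (μ := fun _ : Fin m => (volume : Measure ℝ).restrict (Set.Icc 0 (2 * Real.pi))) g

theorem volume_real_cube : volume.real (cube m) = (2 * Real.pi) ^ m := by
  have h := setIntegral_cube_prod (𝕜 := ℝ) (fun (_ : Fin m) (_ : ℝ) => (1 : ℝ))
  simpa [Real.pi_pos.le] using h

/-- Fubini's theorem isolates the coordinate j, where the integral of a periodic function over a
full period is invariant under shifts. -/
theorem setIntegral_cube_add_single {F : Type*} [NormedAddCommGroup F] [NormedSpace ℝ F]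
    {f : EuclideanSpace ℝ (Fin m) → F} (hf : Continuous f) (hp : IsPeriodic f) (j : Fin m)
    (h : ℝ) :
    ∫ t in cube m, f (t + EuclideanSpace.single j h) = ∫ t in cube m, f t := by
  obtain _ | n := m
  · exact j.elim0
  set μ : Measure ℝ := (volume : Measure ℝ).restrict (Set.Icc 0 (2 * Real.pi)) with hμ
  have key : ∀ g : EuclideanSpace ℝ (Fin (n + 1)) → F, Continuous g →
      ∫ t in cube (n + 1), g t = ∫ z, ∫ y, g (WithLp.toLp 2 (j.insertNth y z)) ∂μ
        ∂(Measure.pi fun _ : Fin n => μ) := by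
    intro g hg
    have h1 := (measurePreserving_piFinSuccAbove (fun _ : Fin (n + 1) => μ) j).symm.integral_comp
      (MeasurableEquiv.measurableEmbedding _) (fun x => g (WithLp.toLp 2 x))
    rw [setIntegral_cube_eq, ← h1]
    rw [integral_prod_symm]
    · rfl
    · have h2 := (measurePreserving_piFinSuccAbove (fun _ : Fin (n + 1) => μ) j).symm.integrable_comp_emb
        (MeasurableEquiv.measurableEmbedding _) (g := fun x => g (WithLp.toLp 2 x))
      refine h2.mpr ?_
      rw [hμ, ← Measure.restrict_pi_pi, ← volume_pi]
      have : IsCompact (Set.pi Set.univ fun _ : Fin (n + 1) => Set.Icc (0 : ℝ) (2 * Real.pi)) :=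
        isCompact_univ_pi fun _ => isCompact_Icc
      exact (hg.comp (PiLp.continuous_toLp 2 _)).continuousOn.integrableOn_compact this
  rw [key _ (by fun_prop), key _ hf]
  congr 1
  ext z
  have hper : Function.Periodic (fun y => f (WithLp.toLp 2 (j.insertNth y z))) (2 * Real.pi) := by
    intro y
    simp only
    rw [← hp j (WithLp.toLp 2 (j.insertNth y z))]
    congr 1
    ext i
    refine j.succAboveCases ?_ (fun i => ?_) i <;> simp
  have hs : ∀ y, f (WithLp.toLp 2 (j.insertNth y z) + EuclideanSpace.single j h)
      = (fun y => f (WithLp.toLp 2 (j.insertNth y z))) (y + h) := by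
    intro y
    simp only
    congr 1
    ext i
    refine j.succAboveCases ?_ (fun i => ?_) i <;> simp
  simp_rw [hs]
  rw [hμ, integral_Icc_eq_integral_Ioc, integral_Icc_eq_integral_Ioc,
    ← intervalIntegral.integral_of_le (by positivity),
    ← intervalIntegral.integral_of_le (by positivity),
    intervalIntegral.integral_comp_add_right (fun y => f (WithLp.toLp 2 (j.insertNth y z)))]
  have := hper.intervalIntegral_add_eq h 0
  rw [zero_add] at this ⊢
  rw [← this, add_comm (2 * Real.pi) h]

theorem setIntegral_Icc_exp (n : ℤ) :
    ∫ x in Set.Icc 0 (2 * Real.pi), Complex.exp (((n : ℝ) * x : ℝ) * Complex.I)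
      = if n = 0 then (2 * Real.pi : ℂ) else 0 := by
  split_ifs with hn
  · subst hn
    simp [Real.pi_pos.le]
  · rw [integral_Icc_eq_integral_Ioc, ← intervalIntegral.integral_of_le (by positivity)]
    have hc : (n : ℂ) * Complex.I ≠ 0 := by simp [hn]
    have h := integral_exp_mul_complex (a := 0) (b := 2 * Real.pi) hc
    have e : ∀ x : ℝ, Complex.exp (((n : ℝ) * x : ℝ) * Complex.I)
        = Complex.exp ((n : ℂ) * Complex.I * x) := by
      intro x; congr 1; push_cast; ring
    simp_rw [e]
    rw [h]
    have : (n : ℂ) * Complex.I * ((2 * Real.pi : ℝ) : ℂ) = n * (2 * Real.pi * Complex.I) := by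
      push_cast; ring
    rw [this, Complex.exp_int_mul_two_pi_mul_I]
    simp

theorem setIntegral_cube_character (k : Fin m → ℤ) :
    ∫ t in cube m, character k t = if k = 0 then (2 * Real.pi : ℂ) ^ m else 0 := by
  simp_rw [character_eq_prod]
  rw [setIntegral_cube_prod (𝕜 := ℂ) fun j x => Complex.exp (((k j : ℝ) * x : ℝ) * Complex.I)]
  simp_rw [setIntegral_Icc_exp]
  split_ifs with hk
  · simp [hk]
  · obtain ⟨j, hj⟩ := Function.ne_iff.mp hk
    exact Finset.prod_eq_zero (Finset.mem_univ j) (by simpa using hj)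

theorem conj_character (k : Fin m → ℤ) (t : EuclideanSpace ℝ (Fin m)) :
    (starRingEnd ℂ) (character k t) = character (-k) t := by
  unfold character
  rw [← Complex.exp_conj]
  simp [Finset.sum_neg_distrib]

/-- Bessel's inequality for bounded continuous functions on the cube. -/
theorem sum_sq_fourierCoefficient_le {f : EuclideanSpace ℝ (Fin m) → ℂ} (hf : Continuous f)
    {B : ℝ} (hB : ∀ t, ‖f t‖ ≤ B) (T : Finset (Fin m → ℤ)) :
    ∑ k ∈ T, ‖fourierCoefficient f k‖ ^ 2 ≤ B ^ 2 := by
  set V : ℝ := (2 * Real.pi) ^ m with hV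
  have hVpos : 0 < V := by positivity
  have hVc : (2 * Real.pi : ℂ) ^ m = (V : ℂ) := by rw [hV]; push_cast; rfl
  set μ : Measure (EuclideanSpace ℝ (Fin m)) := volume.restrict (cube m) with hμ
  have : IsFiniteMeasure μ := ⟨by
    rw [hμ, Measure.restrict_apply_univ]; exact isCompact_cube.measure_lt_top⟩
  have mem : ∀ (g : EuclideanSpace ℝ (Fin m) → ℂ), Continuous g → ∀ C, (∀ t, ‖g t‖ ≤ C) →
      MemLp g 2 μ := fun g hg C hC =>
    MemLp.of_bound hg.aestronglyMeasurable C (Filter.Eventually.of_forall hC)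
  have memc : ∀ k, MemLp (character k : EuclideanSpace ℝ (Fin m) → ℂ) 2 μ := fun k =>
    mem _ (continuous_character k) 1 fun t => (norm_character k t).le
  have memf := mem f hf B hB
  have inn : ∀ (k : Fin m → ℤ) (g) (hg : MemLp g 2 μ), inner ℂ ((memc k).toLp) (hg.toLp) =
      ∫ t in cube m, g t * character (-k) t := by
    intro k g hg
    rw [L2.inner_def]
    refine integral_congr_ae ?_
    filter_upwards [(memc k).coeFn_toLp, hg.coeFn_toLp] with t h1 h2
    rw [h1, h2, RCLike.inner_apply, conj_character]
  have orth : Orthonormal ℂ (fun k : Fin m → ℤ => ((√V)⁻¹ : ℂ) • (memc k).toLp) := by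
    rw [orthonormal_iff_ite]
    intro k l
    rw [inner_smul_left, inner_smul_right, inn]
    simp_rw [← character_add]
    rw [setIntegral_cube_character, hVc]
    have hs : ((√V : ℝ) : ℂ) ^ 2 = V := by
      rw [← Complex.ofReal_pow, Real.sq_sqrt hVpos.le]
    have hs0 : ((√V : ℝ) : ℂ) ≠ 0 := by
      simpa using (Real.sqrt_pos.mpr hVpos).ne'
    by_cases hkl : k = l
    · subst hkl
      simp only [add_neg_cancel, if_true, ← Complex.ofReal_inv, Complex.conj_ofReal]
      push_cast
      field_simp
      exact hs.symm
    · rw [if_neg, if_neg hkl]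
      · simp
      · intro h
        exact hkl (by rw [← sub_eq_add_neg, sub_eq_zero] at h; exact h.symm)
  have bes := orth.sum_inner_products_le (memf.toLp) (s := T)
  have hn : ‖memf.toLp‖ ^ 2 ≤ B ^ 2 * V := by
    rw [← @inner_self_eq_norm_sq ℂ, L2.inner_def]
    have : ∫ a, inner ℂ ((memf.toLp : Lp ℂ 2 μ) a) ((memf.toLp : Lp ℂ 2 μ) a) ∂μ = ((∫ t in cube m, ‖f t‖ ^ 2 : ℝ) : ℂ) := by
      rw [← integral_complex_ofReal]
      refine integral_congr_ae ?_
      filter_upwards [memf.coeFn_toLp] with t h2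
      rw [h2, inner_self_eq_norm_sq_to_K]
      simp
    rw [this]
    simp only [RCLike.re_to_complex, Complex.ofReal_re]
    rw [hV, ← volume_real_cube, mul_comm, ← smul_eq_mul, ← setIntegral_const]
    refine integral_mono (integrableOn_cube (by fun_prop)) (integrableOn_const isCompact_cube.measure_lt_top.ne) ?_
    intro t
    exact pow_le_pow_left₀ (norm_nonneg _) (hB t) 2
  have hterm : ∀ k, ‖inner ℂ (((√V)⁻¹ : ℂ) • (memc k).toLp) (memf.toLp)‖ ^ 2
      = V * ‖fourierCoefficient f k‖ ^ 2 := by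
    intro k
    rw [inner_smul_left, inn, fourierCoefficient_eq, hVc, norm_mul, norm_mul, mul_pow, mul_pow]
    have : ‖(starRingEnd ℂ) ((√V : ℂ)⁻¹)‖ ^ 2 = V⁻¹ := by
      rw [RCLike.norm_conj, norm_inv, Complex.norm_real, inv_pow, Real.norm_eq_abs, sq_abs,
        Real.sq_sqrt hVpos.le]
    rw [this, one_div, norm_inv, Complex.norm_real, Real.norm_of_nonneg hVpos.le]
    field_simp
  simp_rw [hterm] at bes
  rw [← Finset.mul_sum] at bes
  nlinarith [bes.trans hn]

/-- Translation invariance of the integral moves the shift from f onto the character. -/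
theorem fourierCoefficient_difference {f : EuclideanSpace ℝ (Fin m) → ℂ} (hf : Continuous f)
    (hp : IsPeriodic f) (j : Fin m) (h : ℝ) (k : Fin m → ℤ) :
    fourierCoefficient (fun t => f (t + EuclideanSpace.single j h) - f t) k =
      (Complex.exp ((((k j : ℝ) * h : ℝ) : ℂ) * Complex.I) - 1) * fourierCoefficient f k := by
  have hc := continuous_character (-k)
  have key : ∫ t in cube m, f (t + EuclideanSpace.single j h) * character (-k) t
      = character k (EuclideanSpace.single j h) * ∫ t in cube m, f t * character (-k) t := by
    rw [← setIntegral_cube_add_single (f := fun t => f t * character (-k) t) (by fun_prop) (hp.mul (isPeriodic_character _)) j h,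
      ← integral_const_mul]
    congr 1
    ext t
    have : character k (EuclideanSpace.single j h) * character (-k) (EuclideanSpace.single j h) = 1 := by
      rw [← character_add, add_neg_cancel, character_zero]
    rw [character_add_right (-k)]
    linear_combination -(f (t + EuclideanSpace.single j h) * character (-k) t) * this
  simp_rw [fourierCoefficient_eq, sub_mul]
  rw [integral_sub (integrableOn_cube (by fun_prop)) (integrableOn_cube (by fun_prop)), key,
    character_single]
  ring

theorem IsPeriodic.apply_add_int {F : Type*} {f : EuclideanSpace ℝ (Fin m) → F}
    (hf : IsPeriodic f) (n : Fin m → ℤ) (t : EuclideanSpace ℝ (Fin m)) :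
    f (t + WithLp.toLp 2 fun j => (n j : ℝ) * (2 * Real.pi)) = f t := by
  have one : ∀ (j : Fin m) (a : ℤ) (t), f (t + EuclideanSpace.single j ((a : ℝ) * (2 * Real.pi))) = f t := by
    intro j a
    have hp : ∀ t, Function.Periodic (fun s : ℝ => f (t + EuclideanSpace.single j s)) (2 * Real.pi) := by
      intro t s
      simp only
      rw [← hf j (t + EuclideanSpace.single j s), add_assoc]
      congr 2
      ext i
      by_cases hi : i = j <;> simp [hi]
    intro t
    have := (hp t).int_mul a 0
    simp only [zero_add] at this
    rw [this]
    congr 1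
    ext i
    simp
  have sum : ∀ (s : Finset (Fin m)) (t),
      f (t + ∑ j ∈ s, EuclideanSpace.single j ((n j : ℝ) * (2 * Real.pi))) = f t := by
    intro s
    induction s using Finset.induction_on with
    | empty => simp
    | insert j s hj ih =>
      intro t
      rw [Finset.sum_insert hj, ← add_assoc, ih, one]
  rw [← sum Finset.univ t]
  congr 2
  ext i
  simp [Finset.sum_apply, Pi.single_apply]

theorem IsPeriodic.exists_bound {F : Type*} [NormedAddCommGroup F]
    {f : EuclideanSpace ℝ (Fin m) → F} (hf : IsPeriodic f) (hc : Continuous f) :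
    ∃ C, ∀ t, ‖f t‖ ≤ C := by
  obtain ⟨C, hC⟩ := isCompact_cube.exists_bound_of_continuousOn (f := f) hc.continuousOn
  refine ⟨C, fun t => ?_⟩
  rw [← hf.apply_add_int fun j => -⌊t j / (2 * Real.pi)⌋]
  refine hC _ fun j => ?_
  have h2 : (0 : ℝ) < 2 * Real.pi := by positivity
  have h3 := Int.floor_le (t j / (2 * Real.pi))
  have h4 := Int.lt_floor_add_one (t j / (2 * Real.pi))
  rw [le_div_iff₀ h2] at h3
  rw [div_lt_iff₀ h2] at h4
  constructor <;> simp <;> nlinarith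

/-! ### Hölder classes on the line and finite differences -/

/-- Functions on the line which, together with their derivatives up to order `n`, are bounded by
`C`, and whose derivative of order `n` is `α`-Hölder with constant `C` at scales at most `1`. -/
def HolderClass (α : ℝ) : ℕ → ℝ → (ℝ → ℂ) → Prop
  | 0, C, u => (∀ s, ‖u s‖ ≤ C) ∧ ∀ s h, 0 ≤ h → h ≤ 1 → ‖u (s + h) - u s‖ ≤ C * h ^ α
  | n + 1, C, u => (∀ s, ‖u s‖ ≤ C) ∧ Differentiable ℝ u ∧ HolderClass α n C (deriv u)

namespace HolderClass

variable {α C D : ℝ} {n : ℕ} {u v : ℝ → ℂ}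

theorem norm_le (hu : HolderClass α n C u) (s : ℝ) : ‖u s‖ ≤ C := by
  cases n <;> exact hu.1 s

theorem nonneg (hu : HolderClass α n C u) : 0 ≤ C := (norm_nonneg _).trans (hu.norm_le 0)

theorem mono (hCD : C ≤ D) (hu : HolderClass α n C u) : HolderClass α n D u := by
  induction n generalizing u with
  | zero =>
    exact ⟨fun s => (hu.1 s).trans hCD, fun s h h0 h1 => (hu.2 s h h0 h1).trans
      (mul_le_mul_of_nonneg_right hCD (Real.rpow_nonneg h0 _))⟩
  | succ n ih => exact ⟨fun s => (hu.1 s).trans hCD, hu.2.1, ih hu.2.2⟩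

theorem add (hu : HolderClass α n C u) (hv : HolderClass α n D v) :
    HolderClass α n (C + D) (fun s => u s + v s) := by
  induction n generalizing u v with
  | zero =>
    refine ⟨fun s => (norm_add_le _ _).trans (add_le_add (hu.1 s) (hv.1 s)), fun s h h0 h1 => ?_⟩
    rw [add_sub_add_comm, add_mul]
    exact (norm_add_le _ _).trans (add_le_add (hu.2 s h h0 h1) (hv.2 s h h0 h1))
  | succ n ih =>
    refine ⟨fun s => (norm_add_le _ _).trans (add_le_add (hu.1 s) (hv.1 s)),
      hu.2.1.add hv.2.1, ?_⟩
    have : deriv (fun s => u s + v s) = fun s => deriv u s + deriv v s := by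
      ext s
      exact deriv_fun_add (hu.2.1 s) (hv.2.1 s)
    rw [this]
    exact ih hu.2.2 hv.2.2

theorem const_mul {c : ℂ} (hc : ‖c‖ ≤ 1) (hu : HolderClass α n C u) :
    HolderClass α n C (fun s => c * u s) := by
  have key : ∀ {z : ℂ} {B : ℝ}, ‖z‖ ≤ B → ‖c * z‖ ≤ B := fun {z B} hz => by
    rw [norm_mul]
    exact (mul_le_of_le_one_left (norm_nonneg _) hc).trans hz
  induction n generalizing u with
  | zero =>
    refine ⟨fun s => key (hu.1 s), fun s h h0 h1 => ?_⟩
    rw [← mul_sub]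
    exact key (hu.2 s h h0 h1)
  | succ n ih =>
    refine ⟨fun s => key (hu.1 s), hu.2.1.const_mul c, ?_⟩
    have : deriv (fun s => c * u s) = fun s => c * deriv u s := by
      ext s
      exact deriv_const_mul c (hu.2.1 s)
    rw [this]
    exact ih hu.2.2

theorem of_deriv_le (hα : α ≤ 1) (hu : ∀ s, ‖u s‖ ≤ C) (hd : Differentiable ℝ u)
    (hu' : ∀ s, ‖deriv u s‖ ≤ C) : HolderClass α 0 C u := by
  refine ⟨hu, fun s h h0 h1 => ?_⟩
  have hC : 0 ≤ C := (norm_nonneg _).trans (hu 0)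
  have h2 := Convex.norm_image_sub_le_of_norm_deriv_le (𝕜 := ℝ) (f := u) (s := Set.univ)
    (x := s) (y := s + h) (fun x _ => hd x) (fun x _ => hu' x) convex_univ trivial trivial
  refine h2.trans ?_
  rw [add_sub_cancel_left, Real.norm_of_nonneg h0]
  refine mul_le_mul_of_nonneg_left ?_ hC
  rcases h0.eq_or_lt with rfl | h0
  · exact Real.rpow_nonneg le_rfl _
  · simpa using Real.rpow_le_rpow_of_exponent_ge h0 h1 hα

theorem of_succ (hα : α ≤ 1) (hu : HolderClass α (n + 1) C u) : HolderClass α n C u := by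
  induction n generalizing u with
  | zero => exact of_deriv_le hα hu.1 hu.2.1 hu.2.2.1
  | succ n ih => exact ⟨hu.1, hu.2.1, ih hu.2.2⟩

/-- The Leibniz rule produces two products at each order, hence the factor 2 per derivative. -/
theorem mul (hα : α ≤ 1) (hu : HolderClass α n C u) (hv : HolderClass α n D v) :
    HolderClass α n (2 ^ (n + 1) * C * D) (fun s => u s * v s) := by
  have hC := hu.nonneg
  have hD := hv.nonneg
  have hbd : ∀ s, ‖u s * v s‖ ≤ C * D := fun s => by
    rw [norm_mul]
    exact mul_le_mul (hu.norm_le s) (hv.norm_le s) (norm_nonneg _) hC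
  have hbd' : ∀ s, ‖u s * v s‖ ≤ 2 ^ (n + 1) * C * D := fun s => by
    refine (hbd s).trans ?_
    rw [mul_assoc]
    exact le_mul_of_one_le_left (mul_nonneg hC hD) (one_le_pow₀ (by norm_num))
  induction n generalizing u v with
  | zero =>
    refine ⟨hbd', fun s h h0 h1 => ?_⟩
    have : u (s + h) * v (s + h) - u s * v s
        = (u (s + h) - u s) * v (s + h) + u s * (v (s + h) - v s) := by ring
    rw [this]
    refine (norm_add_le _ _).trans ?_
    rw [norm_mul, norm_mul]
    have e1 := mul_le_mul (hu.2 s h h0 h1) (hv.1 (s + h)) (norm_nonneg _)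
      (mul_nonneg hC (Real.rpow_nonneg h0 _))
    have e2 := mul_le_mul (hu.1 s) (hv.2 s h h0 h1) (norm_nonneg _) hC
    refine (add_le_add e1 e2).trans (le_of_eq ?_)
    ring
  | succ n ih =>
    refine ⟨hbd', hu.2.1.mul hv.2.1, ?_⟩
    have : deriv (fun s => u s * v s) = fun s => deriv u s * v s + u s * deriv v s := by
      ext s
      exact deriv_fun_mul (hu.2.1 s) (hv.2.1 s)
    rw [this]
    have mk : ∀ {w z : ℝ → ℂ}, HolderClass α n C w → HolderClass α n D z →
        HolderClass α n (2 ^ (n + 1) * C * D) (fun s => w s * z s) := by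
      intro w z hw hz
      have hb : ∀ s, ‖w s * z s‖ ≤ C * D := fun s => by
        rw [norm_mul]
        exact mul_le_mul (hw.norm_le s) (hz.norm_le s) (norm_nonneg _) hC
      refine ih hw hz hb fun s => (hb s).trans ?_
      rw [mul_assoc]
      exact le_mul_of_one_le_left (mul_nonneg hC hD) (one_le_pow₀ (by norm_num))
    refine ((mk hu.2.2 (hv.of_succ hα)).add (mk (hu.of_succ hα) hv.2.2)).mono (le_of_eq ?_)
    ring

/-- Only γ' is controlled, never γ, so the bound does not see the size of the phase. Since (e^{iγ})'
= iγ' e^{iγ}, control of e^{iγ} at one order yields control at the next. -/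
theorem exists_cexp (hα : α ≤ 1) (n : ℕ) (C : ℝ) : ∃ E, ∀ γ : ℝ → ℝ, Differentiable ℝ γ →
    HolderClass α n C (fun s => ((deriv γ s : ℝ) : ℂ)) →
    HolderClass α (n + 1) E (fun s => Complex.exp (Complex.I * (γ s : ℝ))) := by
  have hder : ∀ γ : ℝ → ℝ, Differentiable ℝ γ → ∀ s,
      HasDerivAt (fun s => Complex.exp (Complex.I * (γ s : ℝ)))
        (Complex.I * (deriv γ s : ℝ) * Complex.exp (Complex.I * (γ s : ℝ))) s := by
    intro γ hγ s
    have := (((hγ s).hasDerivAt.ofReal_comp).const_mul Complex.I).cexp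
    convert this using 1
    ring
  have hone : ∀ (γ : ℝ → ℝ) s, ‖Complex.exp (Complex.I * (γ s : ℝ))‖ = 1 := fun γ s => by
    rw [mul_comm, Complex.norm_exp_ofReal_mul_I]
  have step : ∀ (n : ℕ) (E : ℝ) (γ : ℝ → ℝ), Differentiable ℝ γ →
      HolderClass α n C (fun s => ((deriv γ s : ℝ) : ℂ)) →
      HolderClass α n E (fun s => Complex.exp (Complex.I * (γ s : ℝ))) →
      HolderClass α (n + 1) (1 + 2 ^ (n + 1) * C * E)
        (fun s => Complex.exp (Complex.I * (γ s : ℝ))) := by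
    intro n E γ hγ hγ' hE
    have hm := (hγ'.const_mul (c := Complex.I) (by simp)).mul hα hE
    have h0 := hm.nonneg
    refine ⟨fun s => by rw [hone]; linarith, fun s => (hder γ hγ s).differentiableAt, ?_⟩
    have : deriv (fun s => Complex.exp (Complex.I * (γ s : ℝ)))
        = fun s => Complex.I * (deriv γ s : ℝ) * Complex.exp (Complex.I * (γ s : ℝ)) :=
      funext fun s => (hder γ hγ s).deriv
    rw [this]
    exact hm.mono (by linarith)
  induction n with
  | zero =>
    refine ⟨_, fun γ hγ hγ' => step 0 (1 + C) γ hγ hγ' ?_⟩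
    have hC := hγ'.nonneg
    refine of_deriv_le hα (fun s => by rw [hone]; linarith)
      (fun s => (hder γ hγ s).differentiableAt) fun s => ?_
    rw [(hder γ hγ s).deriv, norm_mul, hone, norm_mul, Complex.norm_I, one_mul, mul_one]
    exact (hγ'.1 s).trans (by linarith)
  | succ n ih =>
    obtain ⟨E, hE⟩ := ih
    exact ⟨_, fun γ hγ hγ' => step (n + 1) E γ hγ hγ' (hE γ hγ (hγ'.of_succ hα))⟩

theorem hasDerivAt_iterate_fwdDiff {u u' : ℝ → ℂ} (h : ℝ) (hu : ∀ s, HasDerivAt u (u' s) s)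
    (n : ℕ) (s : ℝ) : HasDerivAt ((fwdDiff h)^[n] u) ((fwdDiff h)^[n] u' s) s := by
  induction n generalizing s with
  | zero => exact hu s
  | succ n ih =>
    simp only [Function.iterate_succ', Function.comp_apply]
    exact ((ih (s + h)).comp_add_const s h).sub (ih s)

/-- One difference is spent on the Hölder condition for the n-th derivative; each of the other n
gains a factor h by the mean value inequality. -/
theorem norm_iterate_fwdDiff_le (hu : HolderClass α n C u) {h : ℝ} (h0 : 0 ≤ h) (h1 : h ≤ 1)
    (s : ℝ) : ‖(fwdDiff h)^[n + 1] u s‖ ≤ C * h ^ α * h ^ n := by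
  induction n generalizing u s with
  | zero => simpa [fwdDiff] using hu.2 s h h0 h1
  | succ n ih =>
    have hd := hasDerivAt_iterate_fwdDiff h (fun s => (hu.2.1 s).hasDerivAt) (n + 1)
    have := Convex.norm_image_sub_le_of_norm_hasDerivWithin_le (𝕜 := ℝ) (s := Set.univ)
      (x := s) (y := s + h) (fun x _ => (hd x).hasDerivWithinAt) (fun x _ => ih hu.2.2 x)
      convex_univ trivial trivial
    rw [Function.iterate_succ']
    refine this.trans (le_of_eq ?_)
    rw [add_sub_cancel_left, Real.norm_of_nonneg h0]
    ring

end HolderClass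

/-! ### Differences of e^{iλφ} on the scale 1/|λ| -/

/-- Beyond the scale where the Hölder condition is given, the trivial bound 2B takes over; for α = 0
it is all that is needed. -/
theorem LipschitzOrder.exists_bound {F : Type*} [NormedAddCommGroup F] {α : ℝ} (hα : 0 ≤ α)
    {g : EuclideanSpace ℝ (Fin m) → F} {B : ℝ} (hB : ∀ t, ‖g t‖ ≤ B)
    (hg : 0 < α → LipschitzOrder α g) :
    ∃ C, 0 ≤ C ∧ ∀ t u, ‖g (t + u) - g t‖ ≤ C * ‖u‖ ^ α := by
  have hB0 : 0 ≤ B := (norm_nonneg _).trans (hB 0)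
  have h2 : ∀ t u, ‖g (t + u) - g t‖ ≤ 2 * B := fun t u =>
    (norm_sub_le _ _).trans (by linarith [hB (t + u), hB t])
  rcases hα.eq_or_lt with rfl | hα
  · exact ⟨2 * B, by positivity, fun t u => by simpa using h2 t u⟩
  · obtain ⟨C, δ, hδ, hC⟩ := hg hα
    have hpos : 0 < δ ^ α := Real.rpow_pos_of_pos hδ _
    refine ⟨max C (2 * B / δ ^ α), le_max_of_le_right (by positivity), fun t u => ?_⟩
    have hun : 0 ≤ ‖u‖ ^ α := Real.rpow_nonneg (norm_nonneg _) _
    rcases (norm_nonneg u).eq_or_lt with h0 | h0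
    · rw [eq_comm, norm_eq_zero] at h0
      simp [h0, Real.zero_rpow hα.ne']
    · rcases le_or_gt ‖u‖ δ with hle | hgt
      · exact (hC ‖u‖ h0 hle (t + u) t (by simp)).trans
          (mul_le_mul_of_nonneg_right (le_max_left _ _) hun)
      · refine (h2 t u).trans (le_trans ?_ (mul_le_mul_of_nonneg_right (le_max_right _ _) hun))
        rw [div_mul_eq_mul_div, le_div_iff₀ hpos]
        exact mul_le_mul_of_nonneg_left (Real.rpow_le_rpow hδ.le hgt.le hα.le) (by positivity)

theorem IsPeriodic.partialDeriv {F : Type*} [NormedAddCommGroup F] [NormedSpace ℝ F]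
    {f : EuclideanSpace ℝ (Fin m) → F} (hf : IsPeriodic f) (n : ℕ) (J : Fin n → Fin m) :
    IsPeriodic (partialDeriv n J f) := by
  intro j t
  unfold TorusA.partialDeriv
  rw [← iteratedFDeriv_comp_add_right]
  congr 2
  ext x
  exact hf j x

theorem continuous_partialDeriv {F : Type*} [NormedAddCommGroup F] [NormedSpace ℝ F]
    {f : EuclideanSpace ℝ (Fin m) → F} {ν : ℕ} (hf : ContDiff ℝ ν f) {n : ℕ} (hn : n ≤ ν)
    (J : Fin n → Fin m) : Continuous (partialDeriv n J f) :=
  (ContinuousMultilinearMap.apply ℝ (fun _ : Fin n => EuclideanSpace ℝ (Fin m)) F _).continuous.comp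
    (hf.continuous_iteratedFDeriv (by exact_mod_cast hn))

theorem hasDerivAt_partialDeriv {F : Type*} [NormedAddCommGroup F] [NormedSpace ℝ F]
    {f : EuclideanSpace ℝ (Fin m) → F} {ν : ℕ} (hf : ContDiff ℝ ν f) {n : ℕ} (hn : n < ν)
    (j : Fin m) (t : EuclideanSpace ℝ (Fin m)) (s : ℝ) :
    HasDerivAt (fun s => partialDeriv n (fun _ => j) f (t + EuclideanSpace.single j s))
      (partialDeriv (n + 1) (fun _ => j) f (t + EuclideanSpace.single j s)) s := by
  have hline : HasDerivAt (fun s : ℝ => t + EuclideanSpace.single j s)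
      (EuclideanSpace.single j (1 : ℝ)) s := by
    have h1 : (fun s : ℝ => t + EuclideanSpace.single j s)
        = fun s : ℝ => t + s • EuclideanSpace.single j (1 : ℝ) := by
      ext s i
      simp
    rw [h1]
    simpa using ((hasDerivAt_id s).smul_const (EuclideanSpace.single j (1 : ℝ))).const_add t
  have hd := (hf.differentiable_iteratedFDeriv (m := n) (by exact_mod_cast hn)
    (t + EuclideanSpace.single j s)).hasFDerivAt
  have h2 := hd.comp_hasDerivAt s hline
  exact (ContinuousMultilinearMap.apply ℝ (fun _ : Fin n => EuclideanSpace ℝ (Fin m)) F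
    (fun _ => EuclideanSpace.single j (1 : ℝ))).hasFDerivAt.comp_hasDerivAt s h2

theorem partialDeriv_zero {F : Type*} [NormedAddCommGroup F] [NormedSpace ℝ F]
    {f : EuclideanSpace ℝ (Fin m) → F} (J : Fin 0 → Fin m) : partialDeriv 0 J f = f := by
  ext t
  simp [partialDeriv]

/-- Uniform bounds along coordinate lines for the rescaled derivatives of the phase. -/
theorem exists_holderClass_partialDeriv {ν : ℕ} {α : ℝ} (hα₀ : 0 ≤ α)
    {φ : EuclideanSpace ℝ (Fin m) → ℝ} (hφ : MemC ν α φ) :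
    ∃ C, ∀ (j : Fin m) (c R : ℝ), |c| ≤ 1 → 1 ≤ R → ∀ (n i : ℕ), i + 1 + n = ν →
      ∀ t : EuclideanSpace ℝ (Fin m), HolderClass α n C (fun s =>
        ((c * (R⁻¹) ^ i * partialDeriv (i + 1) (fun _ => j) φ (t + EuclideanSpace.single j (s / R)) : ℝ) : ℂ)) := by
  have hb : ∀ (j : Fin m) (i : ℕ), ∃ B, i ≤ ν → ∀ t, ‖partialDeriv i (fun _ => j) φ t‖ ≤ B := by
    intro j i
    by_cases hi : i ≤ ν
    · obtain ⟨B, hB⟩ := (hφ.1.partialDeriv i (fun _ => j)).exists_bound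
        (continuous_partialDeriv hφ.2.1 hi _)
      exact ⟨B, fun _ => hB⟩
    · exact ⟨0, fun h => absurd h hi⟩
  choose B hB using hb
  have hh : ∀ j : Fin m, ∃ H, 0 ≤ H ∧ ∀ t u, ‖partialDeriv ν (fun _ => j) φ (t + u)
      - partialDeriv ν (fun _ => j) φ t‖ ≤ H * ‖u‖ ^ α := fun j =>
    LipschitzOrder.exists_bound hα₀ (hB j ν le_rfl) fun h => hφ.2.2 h _
  choose H hH0 hH using hh
  set C : ℝ := (∑ j : Fin m, ∑ i ∈ Finset.range (ν + 1), |B j i|) + ∑ j, H j with hC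
  have hHC : ∀ j, H j ≤ C := fun j => by
    have hS : 0 ≤ ∑ j : Fin m, ∑ i ∈ Finset.range (ν + 1), |B j i| :=
      Finset.sum_nonneg fun _ _ => Finset.sum_nonneg fun _ _ => abs_nonneg _
    have := Finset.single_le_sum (f := H) (fun j _ => hH0 j) (Finset.mem_univ j)
    linarith
  have hBC : ∀ j i, i ≤ ν → B j i ≤ C := fun j i hi => by
    have h1 := Finset.single_le_sum (f := fun i => |B j i|) (fun i _ => abs_nonneg _)
      (Finset.mem_range.mpr (Nat.lt_succ_of_le hi))
    have h2 := Finset.single_le_sum (f := fun j => ∑ i ∈ Finset.range (ν + 1), |B j i|)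
      (fun j _ => Finset.sum_nonneg fun _ _ => abs_nonneg _) (Finset.mem_univ j)
    have h3 : 0 ≤ ∑ j, H j := Finset.sum_nonneg fun j _ => hH0 j
    have h4 := le_abs_self (B j i)
    linarith
  refine ⟨C, fun j c R hc hR n => ?_⟩
  have hRi : |R⁻¹| ≤ 1 := by
    rw [abs_of_nonneg (by positivity)]
    exact inv_le_one_of_one_le₀ hR
  have hcoef : ∀ i : ℕ, |c * R⁻¹ ^ i| ≤ 1 := fun i => by
    rw [abs_mul, abs_pow]
    exact mul_le_one₀ hc (by positivity) (pow_le_one₀ (abs_nonneg _) hRi)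
  have bound : ∀ i, i + 1 ≤ ν → ∀ t, ‖((c * (R⁻¹) ^ i * partialDeriv (i + 1) (fun _ => j) φ t : ℝ) : ℂ)‖ ≤ C := by
    intro i hi t
    rw [Complex.norm_real, norm_mul]
    exact (mul_le_of_le_one_left (norm_nonneg _) (hcoef i)).trans ((hB j _ hi t).trans (hBC j _ hi))
  induction n with
  | zero =>
    rintro i rfl t
    rw [Nat.add_zero] at *
    refine ⟨fun s => bound _ le_rfl _, fun s h h0 h1 => ?_⟩
    rw [← Complex.ofReal_sub, ← mul_sub, Complex.norm_real, norm_mul]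
    refine (mul_le_of_le_one_left (norm_nonneg _) (hcoef _)).trans ?_
    have e : t + EuclideanSpace.single j ((s + h) / R)
        = t + EuclideanSpace.single j (s / R) + EuclideanSpace.single j (h / R) := by
      ext k
      by_cases hk : k = j
      · subst hk; simp; ring
      · simp [hk]
    rw [e]
    refine (hH j _ _).trans ?_
    refine mul_le_mul (hHC j) ?_ (by positivity) ((hH0 j).trans (hHC j))
    rw [PiLp.norm_single, Real.norm_of_nonneg (by positivity)]
    exact Real.rpow_le_rpow (by positivity) (div_le_self h0 hR) hα₀
  | succ n ih =>
    rintro i hi t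
    -- Differentiating in s releases one factor R⁻¹, so i increases by one while i + 1 + n stays
    -- equal to ν.
    have hd : ∀ s, HasDerivAt (fun s : ℝ => ((c * (R⁻¹) ^ i * partialDeriv (i + 1) (fun _ => j) φ
          (t + EuclideanSpace.single j (s / R)) : ℝ) : ℂ))
        ((c * (R⁻¹) ^ (i + 1) * partialDeriv (i + 1 + 1) (fun _ => j) φ
          (t + EuclideanSpace.single j (s / R)) : ℝ) : ℂ) s := by
      intro s
      apply HasDerivAt.ofReal_comp
      have h1 := (hasDerivAt_partialDeriv hφ.2.1 (show i + 1 < ν by omega) j t (s / R)).scomp s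
        ((hasDerivAt_id s).div_const R)
      have h2 := h1.const_mul (c * (R⁻¹) ^ i)
      refine h2.congr_deriv ?_
      simp only [smul_eq_mul]
      ring
    refine ⟨fun s => bound i (by omega) _, fun s => (hd s).differentiableAt, ?_⟩
    rw [funext fun s => (hd s).deriv]
    exact ih (i + 1) (by omega) t

theorem iterate_fwdDiff_single (f : EuclideanSpace ℝ (Fin m) → ℂ) (j : Fin m)
    (t : EuclideanSpace ℝ (Fin m)) (h R : ℝ) (n : ℕ) (s : ℝ) :
    (fwdDiff h)^[n] (fun s : ℝ => f (t + EuclideanSpace.single j (s / R))) s =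
      (fwdDiff (EuclideanSpace.single j (h / R)))^[n] f (t + EuclideanSpace.single j (s / R)) := by
  induction n generalizing s with
  | zero => rfl
  | succ n ih =>
    rw [Function.iterate_succ', Function.iterate_succ']
    simp only [Function.comp_apply, fwdDiff]
    rw [ih, ih]
    have e : t + EuclideanSpace.single j ((s + h) / R)
        = t + EuclideanSpace.single j (s / R) + EuclideanSpace.single j (h / R) := by
      ext k
      by_cases hk : k = j
      · subst hk; simp; ring
      · simp [hk]
    rw [e]

theorem exists_norm_iterate_fwdDiff_expPhase_le {ν : ℕ} (hν : 1 ≤ ν) {α : ℝ} (hα₀ : 0 ≤ α)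
    (hα₁ : α ≤ 1) {φ : EuclideanSpace ℝ (Fin m) → ℝ} (hφ : MemC ν α φ) :
    ∃ E, 0 ≤ E ∧ ∀ (j : Fin m) (lam R : ℝ), 1 ≤ R → |lam| ≤ R → ∀ h, 0 < h → h ≤ 1 → ∀ t,
      ‖(fwdDiff (EuclideanSpace.single j (h / R)))^[ν + 1] (expPhase φ lam) t‖
        ≤ E * h ^ ((ν : ℝ) + α) := by
  obtain ⟨n, rfl⟩ : ∃ n, ν = n + 1 := ⟨ν - 1, by omega⟩
  obtain ⟨C, hC⟩ := exists_holderClass_partialDeriv hα₀ hφ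
  obtain ⟨E, hE⟩ := HolderClass.exists_cexp hα₁ n C
  refine ⟨|E|, abs_nonneg _, fun j lam R hR hlam h h0 h1 t => ?_⟩
  -- The phase on the scale 1/R: its derivative carries the factor λ/R, of modulus at most 1, so
  -- every bound on it is uniform in λ.
  have hRpos : 0 < R := by linarith
  set γ : ℝ → ℝ := fun s => lam * φ (t + EuclideanSpace.single j (s / R)) with hγ
  have hd : ∀ s, HasDerivAt γ (lam / R * (R⁻¹) ^ 0 * (partialDeriv 1 (fun _ => j) φ
      (t + EuclideanSpace.single j (s / R)) : ℝ)) s := by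
    intro s
    have h1 := (hasDerivAt_partialDeriv hφ.2.1 (Nat.succ_pos n) j t (s / R)).scomp s
        ((hasDerivAt_id s).div_const R)
    simp only [partialDeriv_zero] at h1
    refine (h1.const_mul lam).congr_deriv ?_
    simp only [smul_eq_mul]
    ring
  have hc : |lam / R| ≤ 1 := by
    rw [abs_div, abs_of_pos hRpos]
    exact div_le_one_of_le₀ hlam hRpos.le
  have key := hE γ (fun s => (hd s).differentiableAt) (by
    rw [show deriv γ = _ from funext fun s => (hd s).deriv]
    exact hC j _ R hc hR n 0 (by omega) t)
  have h2 := key.norm_iterate_fwdDiff_le h0.le h1 0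
  have h3 := iterate_fwdDiff_single (expPhase φ lam) j t h R (n + 1 + 1) 0
  have h4 : (fun s : ℝ => expPhase φ lam (t + EuclideanSpace.single j (s / R)))
      = fun s => Complex.exp (Complex.I * (γ s : ℝ)) := rfl
  rw [h4] at h3
  rw [h3] at h2
  have e0 : t + EuclideanSpace.single j (0 / R) = t := by
    ext i; simp
  rw [e0] at h2
  refine h2.trans ?_
  rw [mul_assoc]
  refine mul_le_mul (le_abs_self E) (le_of_eq ?_) (by positivity) (abs_nonneg _)
  rw [← Real.rpow_natCast, ← Real.rpow_add h0]
  congr 1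
  ring

/-! ### Dyadic shells and the upper bound -/

theorem continuous_expPhase {φ : EuclideanSpace ℝ (Fin m) → ℝ} (hφ : Continuous φ) (lam : ℝ) :
    Continuous (expPhase φ lam) := by
  unfold expPhase
  fun_prop

theorem IsPeriodic.expPhase {φ : EuclideanSpace ℝ (Fin m) → ℝ} (hφ : IsPeriodic φ) (lam : ℝ) :
    IsPeriodic (expPhase φ lam) := fun j t => by
  simp only [TorusA.expPhase, hφ j t]

theorem norm_expPhase (φ : EuclideanSpace ℝ (Fin m) → ℝ) (lam : ℝ) (t : EuclideanSpace ℝ (Fin m)) :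
    ‖expPhase φ lam t‖ = 1 := by
  rw [expPhase, mul_comm, Complex.norm_exp_ofReal_mul_I]

theorem continuous_iterate_fwdDiff {f : EuclideanSpace ℝ (Fin m) → ℂ} (hf : Continuous f)
    (v : EuclideanSpace ℝ (Fin m)) (n : ℕ) : Continuous ((fwdDiff v)^[n] f) := by
  induction n with
  | zero => exact hf
  | succ n ih =>
    rw [Function.iterate_succ']
    exact (ih.comp (continuous_add_const v)).sub ih

theorem IsPeriodic.iterate_fwdDiff {f : EuclideanSpace ℝ (Fin m) → ℂ} (hf : IsPeriodic f)
    (v : EuclideanSpace ℝ (Fin m)) (n : ℕ) : IsPeriodic ((fwdDiff v)^[n] f) := by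
  induction n with
  | zero => exact hf
  | succ n ih =>
    rw [Function.iterate_succ']
    intro j t
    simp only [Function.comp_apply, fwdDiff]
    rw [add_right_comm, ih, ih]

theorem fourierCoefficient_iterate_fwdDiff {f : EuclideanSpace ℝ (Fin m) → ℂ} (hf : Continuous f)
    (hp : IsPeriodic f) (j : Fin m) (h : ℝ) (k : Fin m → ℤ) (n : ℕ) :
    fourierCoefficient ((fwdDiff (EuclideanSpace.single j h))^[n] f) k =
      (Complex.exp ((((k j : ℝ) * h : ℝ) : ℂ) * Complex.I) - 1) ^ n * fourierCoefficient f k := by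
  induction n with
  | zero => simp
  | succ n ih =>
    rw [Function.iterate_succ', pow_succ', mul_assoc, ← ih]
    exact fourierCoefficient_difference (continuous_iterate_fwdDiff hf _ n)
      (hp.iterate_fwdDiff _ n) j h k

/-- |e^{iθ} - 1|² = 2 - 2 cos θ, and cos θ ≤ cos 1 ≤ 5/9 on this range because 2 < π. -/
theorem half_le_norm_exp_sub_one {θ : ℝ} (h1 : 1 ≤ |θ|) (h2 : |θ| ≤ 2) :
    1 / 2 ≤ ‖Complex.exp ((θ : ℂ) * Complex.I) - 1‖ := by
  have hcos : Real.cos θ ≤ 5 / 9 := by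
    rw [← Real.cos_abs]
    have : |θ| ≤ Real.pi := by linarith [Real.pi_gt_three]
    exact (Real.cos_le_cos_of_nonneg_of_le_pi (by norm_num) this h1).trans Real.cos_one_le
  have hsq : ‖Complex.exp ((θ : ℂ) * Complex.I) - 1‖ ^ 2 = 2 - 2 * Real.cos θ := by
    rw [← Complex.normSq_eq_norm_sq, Complex.normSq_apply]
    simp only [Complex.sub_re, Complex.sub_im, Complex.exp_ofReal_mul_I_re,
      Complex.exp_ofReal_mul_I_im, Complex.one_re, Complex.one_im]
    nlinarith [Real.sin_sq_add_cos_sq θ]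
  nlinarith [norm_nonneg (Complex.exp ((θ : ℂ) * Complex.I) - 1)]

/-- The integer points of the cube of radius `r`. -/
noncomputable def box (m r : ℕ) : Finset (Fin m → ℤ) :=
  Fintype.piFinset fun _ => Finset.Icc (-(r : ℤ)) r

theorem mem_box {r : ℕ} {k : Fin m → ℤ} : k ∈ box m r ↔ ∀ j, |k j| ≤ (r : ℤ) := by
  simp [box, Fintype.mem_piFinset, abs_le]

theorem card_box (m r : ℕ) : (box m r).card = (2 * r + 1) ^ m := by
  unfold box
  rw [Fintype.card_piFinset_const, Int.card_Icc]
  congr 1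
  omega

theorem box_mono {r r' : ℕ} (h : r ≤ r') : box m r ⊆ box m r' := fun k hk => by
  rw [mem_box] at *
  exact fun j => (hk j).trans (by exact_mod_cast h)

theorem exists_subset_box (T : Finset (Fin m → ℤ)) : ∃ r, T ⊆ box m r := by
  refine ⟨T.sup fun k => Finset.univ.sup fun j => (k j).natAbs, fun k hk => ?_⟩
  rw [mem_box]
  intro j
  have h1 := Finset.le_sup (f := fun k : Fin m → ℤ => Finset.univ.sup fun j => (k j).natAbs) hk
  have h2 := Finset.le_sup (f := fun j => (k j).natAbs) (Finset.mem_univ j)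
  have h3 := h2.trans h1
  rw [Int.abs_eq_natAbs]
  exact_mod_cast h3

/-- Hölder's inequality with exponent 2/p, turning the ℓ² information from Bessel's inequality into
ℓ^p at the price of a cardinality. -/
theorem sum_rpow_le_card_mul {ι : Type*} (T : Finset ι) {a : ι → ℝ} (ha : ∀ i, 0 ≤ a i) {p : ℝ}
    (hp0 : 0 < p) (hp2 : p ≤ 2) :
    ∑ i ∈ T, a i ^ p ≤ (T.card : ℝ) ^ (1 - p / 2) * (∑ i ∈ T, a i ^ 2) ^ (p / 2) := by
  have h := Real.rpow_sum_le_const_mul_sum_rpow T (fun i => a i ^ p) (p := 2 / p)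
    (by rw [le_div_iff₀ hp0]; linarith)
  have h1 : ∀ i, |a i ^ p| = a i ^ p := fun i => abs_of_nonneg (Real.rpow_nonneg (ha i) _)
  have h2 : ∀ i, (a i ^ p) ^ (2 / p) = a i ^ 2 := fun i => by
    rw [← Real.rpow_mul (ha i), mul_div_cancel₀ _ hp0.ne', Real.rpow_two]
  simp_rw [h1, h2] at h
  have hS : 0 ≤ ∑ i ∈ T, a i ^ p := Finset.sum_nonneg fun i _ => Real.rpow_nonneg (ha i) _
  have h3 := Real.rpow_le_rpow (Real.rpow_nonneg hS _) h (by positivity : 0 ≤ p / 2)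
  rw [← Real.rpow_mul hS, Real.mul_rpow (by positivity) (by positivity),
    ← Real.rpow_mul (by positivity)] at h3
  have e1 : 2 / p * (p / 2) = 1 := by field_simp
  have e2 : (2 / p - 1) * (p / 2) = 1 - p / 2 := by field_simp
  rwa [e1, e2, Real.rpow_one] at h3

/-- Every k in the shell has a coordinate with R 2^n < |k_j| ≤ R 2^{n+1}. For that j the multiplier
of the difference has modulus at least 2^{-M}, which costs 4^M in Bessel's inequality; the sum over
the possible j costs m. -/
theorem sum_sq_sdiff_box_le {f : EuclideanSpace ℝ (Fin m) → ℂ} (hf : Continuous f)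
    (hp : IsPeriodic f) {M : ℕ} {R : ℕ} (hR : 1 ≤ R) {h : ℝ} {n : ℕ} (hh : h = ((2 : ℝ) ^ n)⁻¹)
    {B : ℝ} (hB : ∀ j t, ‖(fwdDiff (EuclideanSpace.single j (h / R)))^[M] f t‖ ≤ B) :
    ∑ k ∈ box m (R * 2 ^ (n + 1)) \ box m (R * 2 ^ n), ‖fourierCoefficient f k‖ ^ 2
      ≤ m * (4 ^ M * B ^ 2) := by
  set T := box m (R * 2 ^ (n + 1)) \ box m (R * 2 ^ n) with hT
  have hR0 : (0 : ℝ) < R := by exact_mod_cast hR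
  have h2n : (0 : ℝ) < 2 ^ n := by positivity
  have one : ∀ j : Fin m, ∑ k ∈ T with ((R * 2 ^ n : ℕ) : ℤ) < |k j|, ‖fourierCoefficient f k‖ ^ 2
      ≤ 4 ^ M * B ^ 2 := by
    intro j
    have bes := sum_sq_fourierCoefficient_le
      (continuous_iterate_fwdDiff hf (EuclideanSpace.single j (h / R)) M) (hB j)
      {k ∈ T | ((R * 2 ^ n : ℕ) : ℤ) < |k j|}
    refine le_trans ?_ (mul_le_mul_of_nonneg_left bes (by positivity : (0 : ℝ) ≤ 4 ^ M))
    rw [Finset.mul_sum]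
    refine Finset.sum_le_sum fun k hk => ?_
    rw [Finset.mem_filter, hT, Finset.mem_sdiff, mem_box] at hk
    have hup := hk.1.1 j
    have hlo := hk.2
    have hup' : |(k j : ℝ)| ≤ R * 2 ^ (n + 1) := by exact_mod_cast hup
    have hlo' : R * 2 ^ n < |(k j : ℝ)| := by exact_mod_cast hlo
    rw [fourierCoefficient_iterate_fwdDiff hf hp, norm_mul, mul_pow, ← mul_assoc]
    refine le_mul_of_one_le_left (by positivity) ?_
    have habs : |(k j : ℝ) * (h / R)| = |(k j : ℝ)| / (R * 2 ^ n) := by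
      rw [abs_mul, hh, abs_of_nonneg (by positivity : 0 ≤ ((2 : ℝ) ^ n)⁻¹ / R)]
      field_simp
    have hθ := half_le_norm_exp_sub_one (θ := (k j : ℝ) * (h / R))
      (by rw [habs, le_div_iff₀ (by positivity)]; linarith)
      (by rw [habs, div_le_iff₀ (by positivity)]; rw [pow_succ] at hup'; linarith)
    rw [norm_pow, ← pow_mul, mul_comm M 2, pow_mul, ← mul_pow]
    refine one_le_pow₀ ?_
    nlinarith
  calc ∑ k ∈ T, ‖fourierCoefficient f k‖ ^ 2
      ≤ ∑ k ∈ T, ∑ j : Fin m,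
          if ((R * 2 ^ n : ℕ) : ℤ) < |k j| then ‖fourierCoefficient f k‖ ^ 2 else 0 := by
        refine Finset.sum_le_sum fun k hk => ?_
        rw [hT, Finset.mem_sdiff, mem_box, mem_box] at hk
        obtain ⟨j, hj⟩ := not_forall.mp hk.2
        refine le_trans (le_of_eq ?_) (Finset.single_le_sum
          (fun i _ => by split_ifs <;> positivity) (Finset.mem_univ j))
        rw [if_pos (not_le.mp hj)]
    _ = ∑ j : Fin m, ∑ k ∈ T with ((R * 2 ^ n : ℕ) : ℤ) < |k j|, ‖fourierCoefficient f k‖ ^ 2 := by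
        rw [Finset.sum_comm]
        simp_rw [Finset.sum_filter]
    _ ≤ ∑ j : Fin m, 4 ^ M * B ^ 2 := Finset.sum_le_sum fun j _ => one j
    _ = m * (4 ^ M * B ^ 2) := by simp

/-- The `ℓ^p` estimate from above for the Fourier coefficients of `e^{iλφ}`. -/
theorem exists_summable_expPhase_and_tsum_le {ν : ℕ} (hν : 1 ≤ ν) {α : ℝ} (hα₀ : 0 ≤ α) (hα₁ : α ≤ 1)
    {φ : EuclideanSpace ℝ (Fin m) → ℝ} (hφ : MemC ν α φ) {p : ℝ} (hp0 : 0 < p) (hp2 : p ≤ 2)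
    (hps : (m : ℝ) * (1 - p / 2) < (ν + α) * p) :
    ∃ C, 0 < C ∧ ∀ lam : ℝ, 1 ≤ |lam| →
      Summable (fun k : Fin m → ℤ => ‖fourierCoefficient (expPhase φ lam) k‖ ^ p) ∧
      ∑' k : Fin m → ℤ, ‖fourierCoefficient (expPhase φ lam) k‖ ^ p
        ≤ C * |lam| ^ ((m : ℝ) * (1 - p / 2)) := by
  obtain ⟨E, hE0, hE⟩ := exists_norm_iterate_fwdDiff_expPhase_le hν hα₀ hα₁ hφ
  set s : ℝ := ν + α with hs
  set β : ℝ := (m : ℝ) * (1 - p / 2) with hβ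
  have hp1 : 0 ≤ 1 - p / 2 := by linarith
  have hβ0 : 0 ≤ β := by positivity
  -- The ratio of the bounds for consecutive shells; q < 1 is the smoothness hypothesis `hps`.
  set q : ℝ := 2 ^ (β - s * p) with hq
  have hq0 : 0 < q := by positivity
  have hq1 : q < 1 := Real.rpow_lt_one_of_one_lt_of_neg (by norm_num) (by linarith)
  -- The 5 comes from counting points: 2R + 1 ≤ 5R and 2 · R 2^{n+1} + 1 ≤ 5 R 2^n.
  set K : ℝ := 5 ^ β * (1 + (m * (4 ^ (ν + 1) * E ^ 2)) ^ (p / 2)) with hK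
  have hK0 : 0 < K := by positivity
  have hmono : (5 : ℝ) ^ β ≤ K := le_mul_of_one_le_right (by positivity) (by
    have : 0 ≤ ((m : ℝ) * (4 ^ (ν + 1) * E ^ 2)) ^ (p / 2) := by positivity
    linarith)
  -- The summand 1 accounts for the central box, (1 - q)⁻¹ for all shells, and 2^β for replacing R
  -- by 2|λ|.
  refine ⟨K * (1 + (1 - q)⁻¹) * 2 ^ β, by
    have : 0 < 1 - q := by linarith
    positivity, fun lam hlam => ?_⟩
  obtain ⟨R, hR1, hlR, hRl⟩ : ∃ R : ℕ, 1 ≤ R ∧ |lam| ≤ R ∧ (R : ℝ) ≤ 2 * |lam| := by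
    refine ⟨⌈|lam|⌉₊, Nat.one_le_ceil_iff.mpr (by linarith), Nat.le_ceil _, ?_⟩
    have := Nat.ceil_lt_add_one (abs_nonneg lam)
    linarith
  have hR1' : (1 : ℝ) ≤ R := by exact_mod_cast hR1
  set a : (Fin m → ℤ) → ℝ := fun k => ‖fourierCoefficient (expPhase φ lam) k‖ with ha
  have ha0 : ∀ k, 0 ≤ a k := fun k => norm_nonneg _
  have hf := continuous_expPhase hφ.2.1.continuous lam
  have hper := hφ.1.expPhase lam
  have cardpow : ∀ (T : Finset (Fin m → ℤ)) (x : ℝ), 0 ≤ x → (T.card : ℝ) ≤ x ^ m →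
      (T.card : ℝ) ^ (1 - p / 2) ≤ x ^ β := by
    intro T x hx hT
    refine (Real.rpow_le_rpow (by positivity) hT hp1).trans (le_of_eq ?_)
    rw [← Real.rpow_natCast, ← Real.rpow_mul hx]
  have base : ∑ k ∈ box m R, a k ^ p ≤ K * R ^ β := by
    refine (sum_rpow_le_card_mul _ ha0 hp0 hp2).trans ?_
    have h1 : (∑ k ∈ box m R, a k ^ 2) ^ (p / 2) ≤ 1 := by
      refine Real.rpow_le_one (by positivity) ?_ (by positivity)
      simpa using sum_sq_fourierCoefficient_le hf (fun t => (norm_expPhase φ lam t).le) (box m R)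
    have h2 := cardpow (box m R) (5 * R) (by positivity) (by
      rw [card_box]
      push_cast
      exact pow_le_pow_left₀ (by positivity) (by linarith) m)
    rw [Real.mul_rpow (by norm_num) (by positivity)] at h2
    calc _ ≤ ((5 : ℝ) ^ β * R ^ β) * 1 := mul_le_mul h2 h1 (by positivity) (by positivity)
      _ ≤ K * R ^ β := by
        rw [mul_one]
        exact mul_le_mul_of_nonneg_right hmono (by positivity)
  have shell : ∀ n : ℕ, ∑ k ∈ box m (R * 2 ^ (n + 1)) \ box m (R * 2 ^ n), a k ^ p
      ≤ K * R ^ β * q ^ n := by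
    intro n
    refine (sum_rpow_le_card_mul _ ha0 hp0 hp2).trans ?_
    have hh0 : (0 : ℝ) < ((2 : ℝ) ^ n)⁻¹ := by positivity
    have hh1 : ((2 : ℝ) ^ n)⁻¹ ≤ 1 := inv_le_one_of_one_le₀ (one_le_pow₀ (by norm_num))
    have h1 := sum_sq_sdiff_box_le hf hper (M := ν + 1) hR1 (n := n) rfl
      (fun j t => hE j lam R hR1' hlR _ hh0 hh1 t)
    have h2 := cardpow (box m (R * 2 ^ (n + 1)) \ box m (R * 2 ^ n)) (5 * R * 2 ^ n)
      (by positivity) (by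
      have hc : ((box m (R * 2 ^ (n + 1)) \ box m (R * 2 ^ n)).card : ℝ)
          ≤ ((box m (R * 2 ^ (n + 1))).card : ℝ) := by
        exact_mod_cast Finset.card_le_card Finset.sdiff_subset
      refine hc.trans ?_
      rw [card_box]
      push_cast
      refine pow_le_pow_left₀ (by positivity) ?_ m
      have h3 : (1 : ℝ) ≤ R * 2 ^ n := one_le_mul_of_one_le_of_one_le hR1' (one_le_pow₀ (by norm_num))
      rw [pow_succ]
      linarith)
    have h3 := Real.rpow_le_rpow (by positivity) h1 (by positivity : 0 ≤ p / 2)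
    have h4 : ((m : ℝ) * (4 ^ (ν + 1) * (E * (((2 : ℝ) ^ n)⁻¹) ^ s) ^ 2)) ^ (p / 2)
        = (m * (4 ^ (ν + 1) * E ^ 2)) ^ (p / 2) * (2 : ℝ) ^ (-(n * (s * p))) := by
      have : (m : ℝ) * (4 ^ (ν + 1) * (E * (((2 : ℝ) ^ n)⁻¹) ^ s) ^ 2)
          = (m * (4 ^ (ν + 1) * E ^ 2)) * ((((2 : ℝ) ^ n)⁻¹) ^ s) ^ 2 := by ring
      rw [this, Real.mul_rpow (by positivity) (by positivity)]
      congr 1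
      rw [← Real.rpow_natCast, ← Real.rpow_natCast, ← Real.rpow_neg (by norm_num),
        ← Real.rpow_mul (by positivity), ← Real.rpow_mul (by positivity),
        ← Real.rpow_mul (by positivity)]
      congr 1
      push_cast
      ring
    rw [h4] at h3
    have h5 : ((5 : ℝ) * R * 2 ^ n) ^ β = 5 ^ β * R ^ β * 2 ^ (n * β) := by
      rw [Real.mul_rpow (by positivity) (by positivity), Real.mul_rpow (by positivity) (by positivity),
        ← Real.rpow_natCast, ← Real.rpow_mul (by norm_num)]
    rw [h5] at h2
    have h6 : q ^ n = 2 ^ (n * β) * (2 : ℝ) ^ (-(n * (s * p))) := by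
      rw [hq, ← Real.rpow_natCast, ← Real.rpow_mul (by norm_num), ← Real.rpow_add (by norm_num)]
      congr 1
      ring
    refine (mul_le_mul h2 h3 (by positivity) (by positivity)).trans ?_
    rw [h6]
    have h7 : 5 ^ β * ((m : ℝ) * (4 ^ (ν + 1) * E ^ 2)) ^ (p / 2) ≤ K := by
      rw [hK]
      exact mul_le_mul_of_nonneg_left (by linarith) (by positivity)
    calc _ = (5 ^ β * ((m : ℝ) * (4 ^ (ν + 1) * E ^ 2)) ^ (p / 2)) *
          (R ^ β * (2 ^ (n * β) * (2 : ℝ) ^ (-(n * (s * p))))) := by ring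
      _ ≤ K * (R ^ β * (2 ^ (n * β) * (2 : ℝ) ^ (-(n * (s * p))))) :=
        mul_le_mul_of_nonneg_right h7 (by positivity)
      _ = _ := by ring
  have boxes : ∀ n : ℕ, ∑ k ∈ box m (R * 2 ^ n), a k ^ p
      ≤ K * R ^ β * (1 + ∑ i ∈ Finset.range n, q ^ i) := by
    intro n
    induction n with
    | zero => simpa using base
    | succ n ih =>
      have hsub : box m (R * 2 ^ n) ⊆ box m (R * 2 ^ (n + 1)) :=
        box_mono (Nat.mul_le_mul_left _ (Nat.pow_le_pow_right (by norm_num) (Nat.le_succ n)))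
      rw [← Finset.sum_sdiff hsub, Finset.sum_range_succ]
      linarith [shell n]
  have total : ∀ T : Finset (Fin m → ℤ), ∑ k ∈ T, a k ^ p
      ≤ K * (1 + (1 - q)⁻¹) * 2 ^ β * |lam| ^ β := by
    intro T
    obtain ⟨r, hr⟩ := exists_subset_box T
    have hrn : r ≤ R * 2 ^ r := (Nat.lt_two_pow_self).le.trans (Nat.le_mul_of_pos_left _ hR1)
    refine (Finset.sum_le_sum_of_subset_of_nonneg (hr.trans (box_mono hrn))
      fun k _ _ => Real.rpow_nonneg (ha0 k) _).trans ((boxes r).trans ?_)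
    have hgeom : ∑ i ∈ Finset.range r, q ^ i ≤ (1 - q)⁻¹ := by
      rw [← tsum_geometric_of_lt_one hq0.le hq1]
      exact (summable_geometric_of_lt_one hq0.le hq1).sum_le_tsum _ fun i _ => by positivity
    have hRβ : (R : ℝ) ^ β ≤ 2 ^ β * |lam| ^ β := by
      rw [← Real.mul_rpow (by norm_num) (abs_nonneg _)]
      exact Real.rpow_le_rpow (by positivity) hRl hβ0
    have hinv : 0 < (1 - q)⁻¹ := inv_pos.mpr (by linarith)
    calc K * R ^ β * (1 + ∑ i ∈ Finset.range r, q ^ i)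
        ≤ K * (2 ^ β * |lam| ^ β) * (1 + (1 - q)⁻¹) := by gcongr
      _ = _ := by ring
  have hsum : Summable (fun k => a k ^ p) :=
    summable_of_sum_le (fun k => Real.rpow_nonneg (ha0 k) _) total
  exact ⟨hsum, hsum.tsum_le_of_sum_le total⟩

/-! ### Trigonometric windows -/

/-- `W` is a convex combination of characters. -/
def IsCharacterAverage (W : EuclideanSpace ℝ (Fin m) → ℂ) : Prop :=
  ∃ (ι : Type) (_ : Fintype ι) (c : ι → ℝ) (n : ι → Fin m → ℤ), (∀ i, 0 ≤ c i) ∧ ∑ i, c i = 1 ∧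
    ∀ t, W t = ∑ i, (c i : ℂ) * character (n i) t

namespace IsCharacterAverage

variable {V W : EuclideanSpace ℝ (Fin m) → ℂ}

theorem one : IsCharacterAverage (m := m) (fun _ => 1) :=
  ⟨Unit, inferInstance, fun _ => 1, fun _ => 0, by simp, by simp, fun t => by simp [character_zero]⟩

theorem mul (hV : IsCharacterAverage V) (hW : IsCharacterAverage W) :
    IsCharacterAverage fun t => V t * W t := by
  obtain ⟨ι, _, c, n, hc, hc1, hVt⟩ := hV
  obtain ⟨κ, _, d, l, hd, hd1, hWt⟩ := hW
  refine ⟨ι × κ, inferInstance, fun x => c x.1 * d x.2, fun x => n x.1 + l x.2,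
    fun x => mul_nonneg (hc _) (hd _), ?_, fun t => ?_⟩
  · rw [← Finset.univ_product_univ, Finset.sum_product]
    simp only [← Finset.mul_sum, hd1, mul_one, hc1]
  · simp only
    rw [hVt, hWt, Finset.sum_mul_sum, ← Finset.univ_product_univ, Finset.sum_product]
    refine Finset.sum_congr rfl fun i _ => Finset.sum_congr rfl fun j _ => ?_
    rw [character_add]
    push_cast
    ring

theorem pow (hV : IsCharacterAverage V) (N : ℕ) : IsCharacterAverage fun t => V t ^ N := by
  induction N with
  | zero => simpa using one
  | succ N ih => simpa only [pow_succ] using ih.mul hV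

theorem prod {ι : Type*} (s : Finset ι) {V : ι → EuclideanSpace ℝ (Fin m) → ℂ}
    (hV : ∀ i, IsCharacterAverage (V i)) : IsCharacterAverage fun t => ∏ i ∈ s, V i t := by
  classical
  induction s using Finset.induction_on with
  | empty => simpa using one
  | insert i s hi ih => simpa only [Finset.prod_insert hi] using (hV i).mul ih

theorem one_add_cos (j : Fin m) :
    IsCharacterAverage fun t : EuclideanSpace ℝ (Fin m) => (((1 + Real.cos (t j)) / 2 : ℝ) : ℂ) := by
  refine ⟨Fin 3, inferInstance, ![1 / 2, 1 / 4, 1 / 4], ![0, Pi.single j 1, Pi.single j (-1)],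
    ?_, ?_, fun t => ?_⟩
  · intro i
    fin_cases i <;> norm_num
  · rw [Fin.sum_univ_three]
    simp only [Matrix.cons_val_zero, Matrix.cons_val_one, Matrix.cons_val]
    norm_num
  · have h : ∀ a : ℤ, character (Pi.single j a) t = Complex.exp (((a : ℝ) * t j : ℝ) * Complex.I) := by
      intro a
      unfold character
      congr 3
      rw [Finset.sum_eq_single j]
      · simp
      · intro b _ hb
        simp [hb]
      · simp
    rw [Fin.sum_univ_three]
    simp only [Matrix.cons_val_zero, Matrix.cons_val_one, Matrix.cons_val, h, character_zero]
    push_cast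
    rw [Complex.cos]
    ring_nf

end IsCharacterAverage

/-- The window `∏ⱼ ((1 + cos uⱼ) / 2) ^ N`. -/
noncomputable def window (N : ℕ) (u : EuclideanSpace ℝ (Fin m)) : ℝ :=
  ∏ j, ((1 + Real.cos (u j)) / 2) ^ N

theorem isCharacterAverage_window (N : ℕ) :
    IsCharacterAverage fun u : EuclideanSpace ℝ (Fin m) => (window N u : ℂ) := by
  unfold window
  push_cast
  refine IsCharacterAverage.prod _ fun j => ?_
  simpa using (IsCharacterAverage.one_add_cos j).pow N

/-- Multiplication by a character shifts frequencies, and centring the window at t₀ only changes the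
phases of its coefficients, so the bound does not depend on t₀. -/
theorem norm_setIntegral_characterAverage_le {f : EuclideanSpace ℝ (Fin m) → ℂ} (hf : Continuous f)
    {ι : Type*} [Fintype ι] {c : ι → ℝ} {n : ι → Fin m → ℤ} (hc : ∀ i, 0 ≤ c i)
    {W : EuclideanSpace ℝ (Fin m) → ℂ} (hW : ∀ t, W t = ∑ i, (c i : ℂ) * character (n i) t)
    (t₀ : EuclideanSpace ℝ (Fin m)) (k : Fin m → ℤ) :
    ‖∫ t in cube m, W (t - t₀) * (f t * character (-k) t)‖
      ≤ (2 * Real.pi) ^ m * ∑ i, c i * ‖fourierCoefficient f (k - n i)‖ := by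
  have h1 : ∀ t, W (t - t₀) * (f t * character (-k) t)
      = ∑ i, ((c i : ℂ) * character (n i) (-t₀)) * (f t * character (-(k - n i)) t) := by
    intro t
    rw [hW, Finset.sum_mul]
    refine Finset.sum_congr rfl fun i _ => ?_
    rw [sub_eq_add_neg t t₀, character_add_right, neg_sub, sub_eq_add_neg, character_add]
    ring
  simp_rw [h1]
  have hcont : ∀ l : Fin m → ℤ, Continuous (character l) := continuous_character
  rw [integral_finsetSum _ fun i _ => integrableOn_cube (by
    have := hcont (-(k - n i))
    fun_prop), Finset.mul_sum]
  refine (norm_sum_le _ _).trans (Finset.sum_le_sum fun i _ => le_of_eq ?_)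
  rw [integral_const_mul, fourierCoefficient_eq, norm_mul, norm_mul, norm_mul, norm_character,
    Complex.norm_real, Real.norm_of_nonneg (hc i)]
  have : ‖1 / (2 * Real.pi : ℂ) ^ m‖ = ((2 * Real.pi) ^ m)⁻¹ := by
    rw [one_div, norm_inv, norm_pow, norm_mul, Complex.norm_real, Real.norm_of_nonneg Real.pi_pos.le]
    simp
  rw [this]
  have : (2 * Real.pi) ^ m ≠ 0 := by positivity
  field_simp

/-- The integral of `((1 + cos x) / 2) ^ N` over a period. -/
noncomputable def windowIntegral (N : ℕ) : ℝ :=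
  ∫ x in (0 : ℝ)..2 * Real.pi, ((1 + Real.cos x) / 2) ^ N

/-- The derivative of sin x · ((1 + cos x)/2)^N integrates to zero over a period. -/
theorem windowIntegral_succ (N : ℕ) :
    (2 * N + 2) * windowIntegral (N + 1) = (2 * N + 1) * windowIntegral N := by
  have hd : ∀ x : ℝ, HasDerivAt (fun x => Real.sin x * ((1 + Real.cos x) / 2) ^ N)
      ((2 * N + 2) * ((1 + Real.cos x) / 2) ^ (N + 1)
        - (2 * N + 1) * ((1 + Real.cos x) / 2) ^ N) x := by
    intro x
    have h1 : HasDerivAt (fun x => (1 + Real.cos x) / 2) (-Real.sin x / 2) x :=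
      ((Real.hasDerivAt_cos x).const_add 1).div_const 2
    refine ((Real.hasDerivAt_sin x).mul (h1.pow N)).congr_deriv ?_
    have hs : Real.sin x ^ 2 = 1 - Real.cos x ^ 2 := by
      linarith [Real.sin_sq_add_cos_sq x]
    cases N with
    | zero => simp; ring
    | succ N =>
      simp only [Nat.add_sub_cancel, Pi.pow_apply]
      push_cast
      linear_combination (-(N + 1 : ℝ) * ((1 + Real.cos x) / 2) ^ N / 2) * hs
  have h2 := intervalIntegral.integral_eq_sub_of_hasDerivAt (a := 0) (b := 2 * Real.pi)
    (fun x _ => hd x) (Continuous.intervalIntegrable (by fun_prop) _ _)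
  rw [intervalIntegral.integral_sub (Continuous.intervalIntegrable (by fun_prop) _ _)
    (Continuous.intervalIntegrable (by fun_prop) _ _), intervalIntegral.integral_const_mul,
    intervalIntegral.integral_const_mul] at h2
  simp only [Real.sin_two_pi, Real.sin_zero, zero_mul, sub_zero] at h2
  exact sub_eq_zero.mp h2

theorem windowIntegral_zero : windowIntegral 0 = 2 * Real.pi := by simp [windowIntegral]

theorem windowIntegral_pos (N : ℕ) : 0 < windowIntegral N := by
  induction N with
  | zero => rw [windowIntegral_zero]; positivity
  | succ N ih =>
    have h := windowIntegral_succ N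
    have h1 : 0 < (2 * (N : ℝ) + 2) * windowIntegral (N + 1) := by rw [h]; positivity
    exact pos_of_mul_pos_right h1 (by positivity)

/-- By the recursion this quantity is nondecreasing in N, and for N = 1 it equals π². It gives the
mass N^{-1/2} expected of a window of width N^{-1/2}. -/
theorem one_le_mul_windowIntegral_sq {N : ℕ} (hN : 1 ≤ N) : 1 ≤ N * windowIntegral N ^ 2 := by
  induction N, hN using Nat.le_induction with
  | base =>
    have h := windowIntegral_succ 0
    rw [windowIntegral_zero] at h
    have : windowIntegral 1 = Real.pi := by
      norm_num at h
      linarith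
    rw [this, Nat.cast_one]
    nlinarith [Real.pi_gt_three]
  | succ N hN ih =>
    have h := windowIntegral_succ N
    have hN0 : (0 : ℝ) < N + 1 := by positivity
    have h1 : windowIntegral (N + 1) = (2 * N + 1) / (2 * (N + 1)) * windowIntegral N := by
      field_simp
      linarith
    rw [h1]
    push_cast
    have h2 : (N + 1 : ℝ) * ((2 * N + 1) / (2 * (N + 1)) * windowIntegral N) ^ 2
        = N * windowIntegral N ^ 2 + windowIntegral N ^ 2 / (4 * (N + 1)) := by
      field_simp
      ring
    rw [h2]
    have : 0 ≤ windowIntegral N ^ 2 / (4 * (N + 1)) := by positivity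
    linarith

theorem setIntegral_Icc_shift {g : ℝ → ℝ} (hg : Function.Periodic g (2 * Real.pi)) (a : ℝ) :
    ∫ x in Set.Icc 0 (2 * Real.pi), g (x - a) = ∫ x in (0 : ℝ)..2 * Real.pi, g x := by
  rw [integral_Icc_eq_integral_Ioc, ← intervalIntegral.integral_of_le (by positivity),
    intervalIntegral.integral_comp_sub_right]
  have := hg.intervalIntegral_add_eq (-a) 0
  rw [zero_add] at this
  rw [← this]
  congr 1 <;> ring

theorem setIntegral_window (N : ℕ) (t₀ : EuclideanSpace ℝ (Fin m)) :
    ∫ t in cube m, window N (t - t₀) = windowIntegral N ^ m := by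
  have h := setIntegral_cube_prod (𝕜 := ℝ) fun (j : Fin m) x => ((1 + Real.cos (x - t₀ j)) / 2) ^ N
  have h1 : ∀ j : Fin m, ∫ x in Set.Icc 0 (2 * Real.pi), ((1 + Real.cos (x - t₀ j)) / 2) ^ N
      = windowIntegral N := fun j =>
    setIntegral_Icc_shift (g := fun x => ((1 + Real.cos x) / 2) ^ N)
      (fun x => by simp only [Real.cos_add_two_pi]) (t₀ j)
  simp_rw [h1] at h
  simpa [window] using h

/-- The concentration of the window: 1 - cos plays the role of the squared distance. In the
coordinate i the integrand is twice the difference of consecutive powers, so the recursion evaluates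
it. -/
theorem setIntegral_window_mul_one_sub_cos (N : ℕ) (t₀ : EuclideanSpace ℝ (Fin m)) (i : Fin m) :
    ∫ t in cube m, window N (t - t₀) * (1 - Real.cos (t i - t₀ i))
      = windowIntegral N ^ m / (N + 1) := by
  have h := setIntegral_cube_prod (𝕜 := ℝ) fun (j : Fin m) x => ((1 + Real.cos (x - t₀ j)) / 2) ^ N *
    if j = i then 1 - Real.cos (x - t₀ j) else 1
  have h1 : ∀ j : Fin m, ∫ x in Set.Icc 0 (2 * Real.pi), ((1 + Real.cos (x - t₀ j)) / 2) ^ N *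
      (if j = i then 1 - Real.cos (x - t₀ j) else 1)
      = windowIntegral N * if j = i then ((N : ℝ) + 1)⁻¹ else 1 := by
    intro j
    split_ifs
    · refine (setIntegral_Icc_shift (g := fun x => ((1 + Real.cos x) / 2) ^ N * (1 - Real.cos x))
        (fun x => by simp only [Real.cos_add_two_pi]) (t₀ j)).trans ?_
      have h2 : ∀ x : ℝ, ((1 + Real.cos x) / 2) ^ N * (1 - Real.cos x)
          = 2 * ((1 + Real.cos x) / 2) ^ N - 2 * ((1 + Real.cos x) / 2) ^ (N + 1) := by
        intro x; ring
      simp_rw [h2]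
      rw [intervalIntegral.integral_sub (Continuous.intervalIntegrable (by fun_prop) _ _)
        (Continuous.intervalIntegrable (by fun_prop) _ _), intervalIntegral.integral_const_mul,
        intervalIntegral.integral_const_mul]
      have h3 := windowIntegral_succ N
      change 2 * windowIntegral N - 2 * windowIntegral (N + 1) = _
      have : (N : ℝ) + 1 ≠ 0 := by positivity
      field_simp
      linarith
    · simp only [mul_one]
      exact setIntegral_Icc_shift (g := fun x => ((1 + Real.cos x) / 2) ^ N)
        (fun x => by simp only [Real.cos_add_two_pi]) (t₀ j)
  simp_rw [h1, Finset.prod_mul_distrib, Finset.prod_ite_eq'] at h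
  simpa [window, div_eq_mul_inv] using h

theorem window_nonneg (N : ℕ) (u : EuclideanSpace ℝ (Fin m)) : 0 ≤ window N u :=
  Finset.prod_nonneg fun j _ => pow_nonneg (by linarith [Real.neg_one_le_cos (u j)]) _

theorem continuous_window (N : ℕ) : Continuous (window N : EuclideanSpace ℝ (Fin m) → ℝ) := by
  unfold window
  fun_prop

/-- If `g` differs from a constant of modulus one by at most `1/8 + A ∑ⱼ (1 - cos (tⱼ - t₀ⱼ))`,
then its integral against a sufficiently narrow window at `t₀` is large. -/
theorem half_le_norm_setIntegral_window_mul {g : EuclideanSpace ℝ (Fin m) → ℂ} (hg : Continuous g)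
    {c₀ : ℂ} (hc₀ : ‖c₀‖ = 1) {A : ℝ} {t₀ : EuclideanSpace ℝ (Fin m)}
    (hA : ∀ t, ‖g t - c₀‖ ≤ 1 / 8 + A * ∑ j, (1 - Real.cos (t j - t₀ j))) {N : ℕ}
    (hN : 8 * m * A ≤ N) :
    windowIntegral N ^ m / 2 ≤ ‖∫ t in cube m, (window N (t - t₀) : ℂ) * g t‖ := by
  have hw : Continuous fun t : EuclideanSpace ℝ (Fin m) => window N (t - t₀) :=
    (continuous_window N).comp (by fun_prop)
  have hI : 0 < windowIntegral N ^ m := pow_pos (windowIntegral_pos N) m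
  have h1 : ∫ t in cube m, (window N (t - t₀) : ℂ) * g t
      = (∫ t in cube m, (window N (t - t₀) : ℂ) * (g t - c₀)) + (windowIntegral N ^ m : ℝ) * c₀ := by
    rw [← setIntegral_window N t₀, ← integral_complex_ofReal, ← integral_mul_const,
      ← integral_add (integrableOn_cube (by fun_prop)) (integrableOn_cube (by fun_prop))]
    congr 1
    ext t
    ring
  -- One eighth of the mass comes from the constant term and at most one eighth from the second
  -- moment, by the choice of N; three quarters of the main term survive.
  have h2 : ‖∫ t in cube m, (window N (t - t₀) : ℂ) * (g t - c₀)‖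
      ≤ windowIntegral N ^ m * (1 / 4) := by
    calc ‖∫ t in cube m, (window N (t - t₀) : ℂ) * (g t - c₀)‖
        ≤ ∫ t in cube m, ‖(window N (t - t₀) : ℂ) * (g t - c₀)‖ := norm_integral_le_integral_norm _
      _ ≤ ∫ t in cube m, (window N (t - t₀) * (1 / 8)
            + ∑ j, A * (window N (t - t₀) * (1 - Real.cos (t j - t₀ j)))) := by
          refine integral_mono (integrableOn_cube (by fun_prop)) (integrableOn_cube (by fun_prop)) ?_
          intro t
          simp only [norm_mul, Complex.norm_real, Real.norm_of_nonneg (window_nonneg N (t - t₀))]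
          refine (mul_le_mul_of_nonneg_left (hA t) (window_nonneg _ _)).trans (le_of_eq ?_)
          rw [mul_add, Finset.mul_sum, Finset.mul_sum]
          congr 1
          refine Finset.sum_congr rfl fun j _ => ?_
          ring
      _ = windowIntegral N ^ m * (1 / 8) + ∑ j : Fin m, A * (windowIntegral N ^ m / (N + 1)) := by
          rw [integral_add (integrableOn_cube (by fun_prop)) (integrableOn_cube (by fun_prop)),
            integral_finsetSum _ fun j _ => integrableOn_cube (by fun_prop), integral_mul_const,
            setIntegral_window]
          congr 1
          refine Finset.sum_congr rfl fun j _ => ?_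
          rw [integral_const_mul, setIntegral_window_mul_one_sub_cos]
      _ ≤ windowIntegral N ^ m * (1 / 4) := by
          rw [Finset.sum_const, Finset.card_univ, Fintype.card_fin, nsmul_eq_mul]
          have h3 : (m : ℝ) * (A * (windowIntegral N ^ m / (N + 1)))
              = windowIntegral N ^ m * (m * A / (N + 1)) := by ring
          have h4 : (m : ℝ) * A / (N + 1) ≤ 1 / 8 := by
            rw [div_le_iff₀ (by positivity)]
            linarith
          rw [h3]
          nlinarith
  have h5 : ‖((windowIntegral N ^ m : ℝ) : ℂ) * c₀‖ = windowIntegral N ^ m := by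
    rw [norm_mul, hc₀, mul_one, Complex.norm_real, Real.norm_of_nonneg hI.le]
  rw [h1]
  have h6 := norm_sub_le_norm_add (((windowIntegral N ^ m : ℝ) : ℂ) * c₀)
    (∫ t in cube m, (window N (t - t₀) : ℂ) * (g t - c₀))
  rw [add_comm, h5] at h6
  linarith

/-! ### Linearisation of the phase -/

theorem IsPeriodic.fderiv {F : Type*} [NormedAddCommGroup F] [NormedSpace ℝ F]
    {f : EuclideanSpace ℝ (Fin m) → F} (hf : IsPeriodic f) : IsPeriodic (fderiv ℝ f) := by
  intro j t
  rw [← fderiv_comp_add_right]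
  congr 1
  ext x
  exact hf j x

theorem gradient_apply (φ : EuclideanSpace ℝ (Fin m) → ℝ) (t : EuclideanSpace ℝ (Fin m))
    (j : Fin m) : gradient φ t j = fderiv ℝ φ t (EuclideanSpace.single j 1) := by
  have h := InnerProductSpace.toDual_symm_apply (𝕜 := ℝ) (x := EuclideanSpace.single j (1 : ℝ))
    (y := fderiv ℝ φ t)
  rw [EuclideanSpace.inner_single_right] at h
  simpa [gradient] using h

theorem clm_apply_eq_sum (A : EuclideanSpace ℝ (Fin m) →L[ℝ] ℝ) (u : EuclideanSpace ℝ (Fin m)) :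
    A u = ∑ j, u j * A (EuclideanSpace.single j 1) := by
  have h : u = ∑ j, u j • EuclideanSpace.single j (1 : ℝ) := by
    ext i
    simp [Finset.sum_apply, Pi.single_apply]
  conv_lhs => rw [h]
  simp

/-- The gradient of a function of class `C^{ν,α}` with `ν + α ≥ 2` is Lipschitz. -/
theorem exists_norm_fderiv_sub_le {ν : ℕ} {α : ℝ} (hα₁ : α ≤ 1)
    {φ : EuclideanSpace ℝ (Fin m) → ℝ} (hφ : MemC ν α φ) (hν : 2 ≤ (ν : ℝ) + α) :
    ∃ L, 0 ≤ L ∧ ∀ t u, ‖fderiv ℝ φ (t + u) - fderiv ℝ φ t‖ ≤ L * ‖u‖ := by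
  rcases le_or_gt 2 ν with h2 | h2
  · have hc : ContDiff ℝ 1 (fderiv ℝ φ) :=
      (hφ.2.1.of_le (by exact_mod_cast h2 : ((1 + 1 : ℕ) : WithTop ℕ∞) ≤ ν)).fderiv_right le_rfl
    obtain ⟨L, hL⟩ := hφ.1.fderiv.fderiv.exists_bound (hc.continuous_fderiv one_ne_zero)
    refine ⟨L, (norm_nonneg _).trans (hL 0), fun t u => ?_⟩
    have := Convex.norm_image_sub_le_of_norm_fderiv_le (𝕜 := ℝ) (s := Set.univ) (x := t) (y := t + u)
      (fun x _ => hc.differentiable one_ne_zero x) (fun x _ => hL x) convex_univ trivial trivial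
    simpa using this
  -- Only ν = α = 1 remains, where the first partial derivatives are Lipschitz by assumption.
  · have hν1 : (ν : ℝ) ≤ 1 := by exact_mod_cast Nat.lt_succ_iff.mp h2
    have hα : α = 1 := by linarith
    have hν' : ν = 1 := by
      have : (1 : ℝ) ≤ ν := by linarith
      exact le_antisymm (by exact_mod_cast hν1) (by exact_mod_cast this)
    subst hα hν'
    have hb : ∀ j : Fin m, ∃ C, 0 ≤ C ∧ ∀ t u, ‖partialDeriv 1 (fun _ => j) φ (t + u)
        - partialDeriv 1 (fun _ => j) φ t‖ ≤ C * ‖u‖ ^ (1 : ℝ) := by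
      intro j
      obtain ⟨B, hB⟩ := (hφ.1.partialDeriv 1 (fun _ => j)).exists_bound
        (continuous_partialDeriv hφ.2.1 le_rfl _)
      exact LipschitzOrder.exists_bound zero_le_one hB fun h => hφ.2.2 h _
    choose C hC0 hC using hb
    refine ⟨∑ j, C j, Finset.sum_nonneg fun j _ => hC0 j, fun t u => ?_⟩
    refine ContinuousLinearMap.opNorm_le_bound _ (mul_nonneg (Finset.sum_nonneg fun j _ => hC0 j)
      (norm_nonneg _)) fun v => ?_
    rw [clm_apply_eq_sum, Finset.sum_mul, Finset.sum_mul]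
    refine (norm_sum_le _ _).trans (Finset.sum_le_sum fun j _ => ?_)
    have h := hC j t u
    simp only [partialDeriv, iteratedFDeriv_one_apply, Real.rpow_one] at h
    rw [norm_mul, mul_comm]
    exact mul_le_mul h (PiLp.norm_apply_le v j) (norm_nonneg _)
      (mul_nonneg (hC0 j) (norm_nonneg _))

/-- The mean value inequality on the ball of radius ‖u‖ about t, where the derivative differs from
its value at t by at most L‖u‖. -/
theorem abs_sub_sub_fderiv_le {φ : EuclideanSpace ℝ (Fin m) → ℝ} (hφ : Differentiable ℝ φ) {L : ℝ}
    (hL0 : 0 ≤ L) (hL : ∀ t u, ‖fderiv ℝ φ (t + u) - fderiv ℝ φ t‖ ≤ L * ‖u‖)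
    (t u : EuclideanSpace ℝ (Fin m)) : |φ (t + u) - φ t - fderiv ℝ φ t u| ≤ L * ‖u‖ ^ 2 := by
  have := Convex.norm_image_sub_le_of_norm_hasFDerivWithin_le' (𝕜 := ℝ) (f := φ) (C := L * ‖u‖)
    (s := Metric.closedBall t ‖u‖) (x := t) (y := t + u) (f' := fderiv ℝ φ) (φ := fderiv ℝ φ t)
    (fun x _ => (hφ x).hasFDerivAt.hasFDerivWithinAt) (fun x hx => by
      have h := hL t (x - t)
      rw [add_sub_cancel] at h
      refine h.trans (mul_le_mul_of_nonneg_left ?_ hL0)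
      rwa [← dist_eq_norm]) (convex_closedBall t ‖u‖) (by simp) (by simp)
  rw [add_sub_cancel_left, Real.norm_eq_abs] at this
  linarith

theorem norm_cexp_sub_cexp_le (x y : ℝ) :
    ‖Complex.exp (Complex.I * x) - Complex.exp (Complex.I * y)‖ ≤ |x - y| := by
  have h : Complex.exp (Complex.I * x) - Complex.exp (Complex.I * y)
      = Complex.exp (Complex.I * y) * (Complex.exp (Complex.I * (x - y : ℝ)) - 1) := by
    rw [mul_sub, ← Complex.exp_add, mul_one]
    congr 2
    push_cast
    ring
  rw [h, norm_mul, Complex.norm_exp_I_mul_ofReal, one_mul]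
  exact Real.norm_exp_I_mul_ofReal_sub_one_le

theorem expPhase_mul_character (φ : EuclideanSpace ℝ (Fin m) → ℝ) (lam : ℝ) (k : Fin m → ℤ)
    (t : EuclideanSpace ℝ (Fin m)) : expPhase φ lam t * character (-k) t
      = Complex.exp (Complex.I * ((lam * φ t - ∑ j, (k j : ℝ) * t j : ℝ) : ℂ)) := by
  unfold expPhase character
  rw [← Complex.exp_add]
  congr 1
  push_cast
  simp only [Pi.neg_apply, Int.cast_neg, neg_mul, Finset.sum_neg_distrib]
  ring

/-- Near a point `t₀` where `λ∇φ` is close to `k`, the function `e^{iλφ(t)} e^{-i(k,t)}` is nearly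
constant. -/
theorem norm_expPhase_mul_character_sub_le (hm : 1 ≤ m) {φ : EuclideanSpace ℝ (Fin m) → ℝ}
    (hp : IsPeriodic φ) (hφ : Differentiable ℝ φ) {L : ℝ}
    (hL0 : 0 ≤ L) (hL : ∀ t u, ‖fderiv ℝ φ (t + u) - fderiv ℝ φ t‖ ≤ L * ‖u‖)
    {lam : ℝ} (hlam : 1 ≤ |lam|) {k : Fin m → ℤ} {t₀ : EuclideanSpace ℝ (Fin m)}
    (hk : ∀ j, |lam * gradient φ t₀ j - k j| ≤ 1) (t : EuclideanSpace ℝ (Fin m)) :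
    ‖expPhase φ lam t * character (-k) t - expPhase φ lam t₀ * character (-k) t₀‖
      ≤ 1 / 8 + (L + 2 * m) * (Real.pi ^ 2 / 2) * |lam| * ∑ j, (1 - Real.cos (t j - t₀ j)) := by
  -- Both sides are periodic in t, so t may be moved near t₀, where 1 - cos x ≥ 2x²/π² makes the
  -- cosine sum control ‖t - t₀‖².
  wlog ht : ∀ j, |t j - t₀ j| ≤ Real.pi generalizing t
  · set n : Fin m → ℤ := fun j => -round ((t j - t₀ j) / (2 * Real.pi)) with hn
    set t' := t + WithLp.toLp 2 fun j => (n j : ℝ) * (2 * Real.pi) with ht'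
    have ht'j : ∀ j, t' j - t₀ j = t j - t₀ j + (n j : ℝ) * (2 * Real.pi) := fun j => by
      rw [ht']; simp; ring
    have hclose : ∀ j, |t' j - t₀ j| ≤ Real.pi := by
      intro j
      have h1 := abs_sub_round ((t j - t₀ j) / (2 * Real.pi))
      have h2 : t' j - t₀ j
          = ((t j - t₀ j) / (2 * Real.pi) - round ((t j - t₀ j) / (2 * Real.pi))) * (2 * Real.pi) := by
        rw [ht'j, hn]
        push_cast
        have := Real.pi_ne_zero
        field_simp
        ring
      rw [h2, abs_mul, abs_of_pos (by positivity : 0 < 2 * Real.pi)]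
      nlinarith [Real.pi_pos]
    have key := this t' hclose
    have e1 : expPhase φ lam t' * character (-k) t' = expPhase φ lam t * character (-k) t :=
      ((hp.expPhase lam).mul (isPeriodic_character (-k))).apply_add_int n t
    have e2 : ∀ j, Real.cos (t' j - t₀ j) = Real.cos (t j - t₀ j) := fun j => by
      rw [ht'j, Real.cos_add_int_mul_two_pi]
    rw [e1] at key
    simpa only [e2] using key
  set u := t - t₀ with hu
  have huj : ∀ j, u j = t j - t₀ j := fun j => by simp [hu]
  have htu : t = t₀ + u := by simp [hu]
  simp_rw [← huj] at ht ⊢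
  rw [expPhase_mul_character, expPhase_mul_character]
  refine (norm_cexp_sub_cexp_le _ _).trans ?_
  have hm0 : (0 : ℝ) < m := by exact_mod_cast hm
  have taylor := abs_sub_sub_fderiv_le hφ hL0 hL t₀ u
  rw [← htu] at taylor
  have hsplit : lam * φ t - ∑ j, (k j : ℝ) * t j - (lam * φ t₀ - ∑ j, (k j : ℝ) * t₀ j)
      = lam * (φ t - φ t₀ - fderiv ℝ φ t₀ u) + ∑ j, (lam * gradient φ t₀ j - k j) * u j := by
    have h1 : ∑ j, (lam * gradient φ t₀ j - k j) * u j
        = lam * fderiv ℝ φ t₀ u - ∑ j, (k j : ℝ) * t j + ∑ j, (k j : ℝ) * t₀ j := by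
      rw [clm_apply_eq_sum (fderiv ℝ φ t₀) u, Finset.mul_sum, ← Finset.sum_sub_distrib,
        ← Finset.sum_add_distrib]
      refine Finset.sum_congr rfl fun j _ => ?_
      rw [← gradient_apply, huj]
      ring
    rw [h1]
    ring
  have hlin : |∑ j, (lam * gradient φ t₀ j - k j) * u j| ≤ 1 / 8 + 2 * m * ‖u‖ ^ 2 := by
    rw [EuclideanSpace.real_norm_sq_eq]
    calc |∑ j, (lam * gradient φ t₀ j - k j) * u j|
        ≤ ∑ j, |(lam * gradient φ t₀ j - k j) * u j| := Finset.abs_sum_le_sum_abs _ _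
      -- Young's inequality |x| ≤ 1/(8m) + 2m x² trades the linear error for a total constant 1/8
      -- plus a quadratic term.
      _ ≤ ∑ j, (1 / (8 * m) + 2 * m * u j ^ 2) := by
          refine Finset.sum_le_sum fun j _ => ?_
          rw [abs_mul]
          refine (mul_le_of_le_one_left (abs_nonneg _) (hk j)).trans ?_
          have h3 : 1 / (8 * (m : ℝ)) + 2 * m * u j ^ 2 - |u j|
              = (4 * m * |u j| - 1) ^ 2 / (8 * m) := by
            rw [← sq_abs (u j)]
            field_simp
            ring
          have h4 : 0 ≤ (4 * m * |u j| - 1) ^ 2 / (8 * (m : ℝ)) := by positivity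
          linarith
      _ = 1 / 8 + 2 * m * ∑ j, u j ^ 2 := by
          rw [Finset.sum_add_distrib, ← Finset.mul_sum]
          simp
          field_simp
  have hcos : ‖u‖ ^ 2 ≤ Real.pi ^ 2 / 2 * ∑ j, (1 - Real.cos (u j)) := by
    rw [EuclideanSpace.real_norm_sq_eq, Finset.mul_sum]
    refine Finset.sum_le_sum fun j _ => ?_
    have h3 := Real.cos_le_one_sub_mul_cos_sq (ht j)
    have h4 : Real.pi ^ 2 / 2 * (2 / Real.pi ^ 2 * u j ^ 2) = u j ^ 2 := by
      have := Real.pi_ne_zero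
      field_simp
    rw [← h4]
    exact mul_le_mul_of_nonneg_left (by linarith) (by positivity)
  rw [hsplit]
  refine (abs_add_le _ _).trans ?_
  rw [abs_mul]
  have h5 : |lam| * |φ t - φ t₀ - fderiv ℝ φ t₀ u| ≤ |lam| * (L * ‖u‖ ^ 2) :=
    mul_le_mul_of_nonneg_left taylor (abs_nonneg _)
  have h6 : 2 * m * ‖u‖ ^ 2 ≤ |lam| * (2 * m * ‖u‖ ^ 2) :=
    le_mul_of_one_le_left (by positivity) hlam
  have h7 : |lam| * ((L + 2 * m) * ‖u‖ ^ 2)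
      ≤ |lam| * ((L + 2 * m) * (Real.pi ^ 2 / 2 * ∑ j, (1 - Real.cos (u j)))) := by
    gcongr
  calc _ ≤ |lam| * (L * ‖u‖ ^ 2) + (1 / 8 + |lam| * (2 * m * ‖u‖ ^ 2)) := by linarith
    _ = 1 / 8 + |lam| * ((L + 2 * m) * ‖u‖ ^ 2) := by ring
    _ ≤ 1 / 8 + |lam| * ((L + 2 * m) * (Real.pi ^ 2 / 2 * ∑ j, (1 - Real.cos (u j)))) := by linarith
    _ = _ := by ring

/-! ### Counting frequencies and the lower bound -/

theorem volume_floor_fiber_le (k : Fin m → ℤ) :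
    volume {x : EuclideanSpace ℝ (Fin m) | ∀ j, ⌊x j⌋ = k j} ≤ 1 := by
  have h := (PiLp.volume_preserving_toLp (Fin m)).measure_preimage_equiv
    (f := MeasurableEquiv.toLp 2 (Fin m → ℝ)) {x | ∀ j, ⌊x j⌋ = k j}
  rw [← h]
  have : (MeasurableEquiv.toLp 2 (Fin m → ℝ)) ⁻¹' {x | ∀ j, ⌊x j⌋ = k j}
      = Set.univ.pi fun j => Set.Ico (k j : ℝ) (k j + 1) := by
    ext x
    simp only [Set.mem_preimage, Set.mem_ofPred_eq, Set.mem_univ_pi, Set.mem_Ico,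
      ← Int.floor_eq_iff]
    rfl
  rw [this, Real.volume_pi_Ico]
  simp

open scoped Pointwise in
/-- The dilated range of the gradient comes close to many integer points. -/
theorem exists_finset_floor_gradient {φ : EuclideanSpace ℝ (Fin m) → ℝ} (hp : IsPeriodic φ)
    (hφ : ContDiff ℝ 1 φ) {v : ℝ}
    (hv : ENNReal.ofReal v ≤ volume (Set.range (gradient φ))) (lam : ℝ) :
    ∃ T : Finset (Fin m → ℤ), v * |lam| ^ m ≤ T.card ∧
      ∀ k ∈ T, ∃ t₀, ∀ j, |lam * gradient φ t₀ j - k j| ≤ 1 := by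
  -- The unit cells met by λ∇φ: finitely many because the gradient is bounded, and at least as many
  -- as the measure of the set they cover.
  set S : Set (Fin m → ℤ) := Set.range fun t j => ⌊lam * gradient φ t j⌋ with hS
  have hfin : S.Finite := by
    obtain ⟨B, hB⟩ := hp.fderiv.exists_bound (hφ.continuous_fderiv one_ne_zero)
    have hg : ∀ t j, |lam * gradient φ t j| ≤ |lam| * B := fun t j => by
      rw [abs_mul, gradient_apply]
      refine mul_le_mul_of_nonneg_left ?_ (abs_nonneg _)
      have := (fderiv ℝ φ t).le_opNorm (EuclideanSpace.single j 1)
      rw [PiLp.norm_single, norm_one, mul_one] at this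
      exact this.trans (hB t)
    refine (Set.finite_Icc (fun _ : Fin m => ⌊-(|lam| * B)⌋) (fun _ => ⌊|lam| * B⌋)).subset ?_
    rintro _ ⟨t, rfl⟩
    exact ⟨fun j => Int.floor_le_floor (abs_le.mp (hg t j)).1,
      fun j => Int.floor_le_floor (abs_le.mp (hg t j)).2⟩
  refine ⟨hfin.toFinset, ?_, fun k hk => ?_⟩
  · have hcover : lam • Set.range (gradient φ)
        ⊆ ⋃ k ∈ hfin.toFinset, {x : EuclideanSpace ℝ (Fin m) | ∀ j, ⌊x j⌋ = k j} := by
      rintro _ ⟨_, ⟨t, rfl⟩, rfl⟩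
      simp only [Set.mem_iUnion]
      exact ⟨fun j => ⌊lam * gradient φ t j⌋, by rw [Set.Finite.mem_toFinset]; exact ⟨t, rfl⟩,
        fun j => by simp⟩
    have h1 := (measure_mono (μ := volume) hcover).trans (measure_biUnion_finset_le _ _)
    have h2 : ∑ k ∈ hfin.toFinset, volume {x : EuclideanSpace ℝ (Fin m) | ∀ j, ⌊x j⌋ = k j}
        ≤ (hfin.toFinset.card : ENNReal) := by
      refine (Finset.sum_le_sum fun k _ => volume_floor_fiber_le k).trans ?_
      simp
    rw [Measure.addHaar_smul, finrank_euclideanSpace_fin, abs_pow] at h1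
    have h3 : ENNReal.ofReal (v * |lam| ^ m) ≤ (hfin.toFinset.card : ENNReal) := by
      rw [mul_comm, ENNReal.ofReal_mul (by positivity)]
      exact (mul_le_mul_right hv _).trans (h1.trans h2)
    rwa [← ENNReal.ofReal_natCast, ENNReal.ofReal_le_ofReal_iff (by positivity)] at h3
  · rw [Set.Finite.mem_toFinset] at hk
    obtain ⟨t, rfl⟩ := hk
    refine ⟨t, fun j => ?_⟩
    rw [Int.self_sub_floor, Int.abs_fract]
    exact (Int.fract_lt_one _).le

/-- The `ℓ^p` estimate from below for the Fourier coefficients of `e^{iλφ}`. -/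
theorem exists_le_tsum_expPhase (hm : 1 ≤ m) {ν : ℕ} {α : ℝ} (hα₁ : α ≤ 1)
    {φ : EuclideanSpace ℝ (Fin m) → ℝ} (hφ : MemC ν α φ) (hgrad : NondegenerateGradient φ)
    (hν : 2 ≤ (ν : ℝ) + α) {p : ℝ} (hp : 1 ≤ p) :
    ∃ c, 0 < c ∧ ∀ lam : ℝ, 1 ≤ |lam| →
      Summable (fun k : Fin m → ℤ => ‖fourierCoefficient (expPhase φ lam) k‖ ^ p) →
      c * |lam| ^ ((m : ℝ) * (1 - p / 2))
        ≤ ∑' k : Fin m → ℤ, ‖fourierCoefficient (expPhase φ lam) k‖ ^ p := by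
  obtain ⟨L, hL0, hL⟩ := exists_norm_fderiv_sub_le hα₁ hφ hν
  have hν1 : 1 ≤ ν := by
    have : (1 : ℝ) ≤ ν := by linarith
    exact_mod_cast this
  have hC1 : ContDiff ℝ 1 φ := hφ.2.1.of_le (by exact_mod_cast hν1)
  obtain ⟨v, hv0, hv⟩ : ∃ v : ℝ, 0 < v ∧ ENNReal.ofReal v ≤ volume (Set.range (gradient φ)) := by
    obtain ⟨x, hx0, hx⟩ := ENNReal.lt_iff_exists_real_btwn.mp hgrad
    exact ⟨x, ENNReal.ofReal_pos.mp hx.1, hx.2.le⟩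
  have hm0 : (0 : ℝ) < m := by exact_mod_cast hm
  set A : ℝ := (L + 2 * m) * (Real.pi ^ 2 / 2) with hA
  have hA0 : 0 < A := by positivity
  set D : ℝ := 8 * m * A + 1 with hD
  have hD0 : 0 < D := by positivity
  -- The normalisation of f̂, the lower bound (D|λ|)^{-1/2} for the window mass in each variable
  -- with its power of |λ| removed, and the surviving half.
  set b : ℝ := ((2 * Real.pi) ^ m)⁻¹ * (D ^ (-(1 / 2 : ℝ))) ^ m / 2 with hb
  have hb0 : 0 < b := by positivity
  refine ⟨v * b ^ p, by positivity, fun lam hlam hsum => ?_⟩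
  have hlam0 : 0 < |lam| := by linarith
  -- The least N for which the window is narrow enough; it is of order |λ|, so the width is of order
  -- |λ|^{-1/2}.
  set N : ℕ := ⌈8 * m * (A * |lam|)⌉₊ with hN
  have hN1 : 1 ≤ N := Nat.one_le_ceil_iff.mpr (by positivity)
  have hNle : 8 * m * (A * |lam|) ≤ N := Nat.le_ceil _
  have hNlt : (N : ℝ) ≤ D * |lam| := by
    have := Nat.ceil_lt_add_one (by positivity : 0 ≤ 8 * m * (A * |lam|))
    rw [← hN] at this
    rw [hD]
    linarith
  have hf := continuous_expPhase hC1.continuous lam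
  obtain ⟨ι, _, c, n, hc0, hc1, hW⟩ := isCharacterAverage_window (m := m) N
  obtain ⟨T, hTcard, hT⟩ := exists_finset_floor_gradient hφ.1 hC1 hv lam
  set a : (Fin m → ℤ) → ℝ := fun k => ‖fourierCoefficient (expPhase φ lam) k‖ with ha
  have ha0 : ∀ k, 0 ≤ a k := fun k => norm_nonneg _
  have hIlow : ((D * |lam|) ^ (-(1 / 2 : ℝ))) ≤ windowIntegral N := by
    have h1 := one_le_mul_windowIntegral_sq hN1
    have hI := windowIntegral_pos N
    have h2 : 1 ≤ (D * |lam|) * windowIntegral N ^ 2 :=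
      h1.trans (mul_le_mul_of_nonneg_right hNlt (by positivity))
    rw [Real.rpow_neg (by positivity), ← Real.sqrt_eq_rpow]
    rw [inv_le_comm₀ (Real.sqrt_pos.mpr (by positivity)) hI]
    refine Real.le_sqrt_of_sq_le ?_
    rw [inv_pow, inv_le_iff_one_le_mul₀ (by positivity)]
    exact h2
  have hpoint : ∀ k ∈ T, b * |lam| ^ (-((m : ℝ) / 2)) ≤ ∑ i, c i * a (k - n i) := by
    intro k hk
    obtain ⟨t₀, ht₀⟩ := hT k hk
    have h1 := half_le_norm_setIntegral_window_mul (N := N) (t₀ := t₀) (A := A * |lam|)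
      (g := fun t => expPhase φ lam t * character (-k) t)
      (hf.mul (continuous_character _))
      (c₀ := expPhase φ lam t₀ * character (-k) t₀)
      (by rw [norm_mul, norm_expPhase, norm_character, one_mul])
      (fun t => norm_expPhase_mul_character_sub_le hm hφ.1 (hC1.differentiable one_ne_zero) hL0 hL
        hlam ht₀ t) hNle
    have h2 := norm_setIntegral_characterAverage_le hf hc0 hW t₀ k
    have h3 := h1.trans h2
    have h4 : ((D * |lam|) ^ (-(1 / 2 : ℝ))) ^ m ≤ windowIntegral N ^ m :=
      pow_le_pow_left₀ (by positivity) hIlow m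
    have h5 : b * |lam| ^ (-((m : ℝ) / 2))
        = ((2 * Real.pi) ^ m)⁻¹ * (((D * |lam|) ^ (-(1 / 2 : ℝ))) ^ m / 2) := by
      have : (|lam| ^ (-(1 / 2 : ℝ))) ^ m = |lam| ^ (-((m : ℝ) / 2)) := by
        rw [← Real.rpow_natCast, ← Real.rpow_mul hlam0.le]
        congr 1
        ring
      rw [Real.mul_rpow hD0.le hlam0.le, mul_pow (D ^ _), this, hb]
      ring
    rw [h5, inv_mul_le_iff₀ (by positivity)]
    linarith
  -- Jensen's inequality for x^p; it brings the mean outside the power, so that the sum over k can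
  -- be taken for each shift n i separately.
  have hJ : ∀ k ∈ T, (b * |lam| ^ (-((m : ℝ) / 2))) ^ p ≤ ∑ i, c i * a (k - n i) ^ p := by
    intro k hk
    exact (Real.rpow_le_rpow (by positivity) (hpoint k hk) (by linarith)).trans
      (Real.rpow_arith_mean_le_arith_mean_rpow _ c _ (fun i _ => hc0 i) hc1 (fun i _ => ha0 _) hp)
  -- For fixed i the shifted frequencies are distinct, so overlaps between different k cost nothing.
  have hshift : ∀ i, ∑ k ∈ T, a (k - n i) ^ p ≤ ∑' k, a k ^ p := by
    intro i
    have h1 : ∑ k ∈ T, a (k - n i) ^ p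
        = ∑ k ∈ T.map (Equiv.subRight (n i)).toEmbedding, a k ^ p := by
      rw [Finset.sum_map]; rfl
    rw [h1]
    exact hsum.sum_le_tsum _ fun k _ => Real.rpow_nonneg (ha0 k) _
  calc v * b ^ p * |lam| ^ ((m : ℝ) * (1 - p / 2))
      = v * |lam| ^ m * (b * |lam| ^ (-((m : ℝ) / 2))) ^ p := by
        rw [Real.mul_rpow hb0.le (by positivity), ← Real.rpow_mul hlam0.le]
        have : (m : ℝ) * (1 - p / 2) = m + -((m : ℝ) / 2) * p := by ring
        rw [this, Real.rpow_add hlam0, Real.rpow_natCast]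
        ring
    _ ≤ T.card * (b * |lam| ^ (-((m : ℝ) / 2))) ^ p :=
        mul_le_mul_of_nonneg_right hTcard (by positivity)
    _ = ∑ k ∈ T, (b * |lam| ^ (-((m : ℝ) / 2))) ^ p := by simp
    _ ≤ ∑ k ∈ T, ∑ i, c i * a (k - n i) ^ p := Finset.sum_le_sum hJ
    _ = ∑ i, c i * ∑ k ∈ T, a (k - n i) ^ p := by
        rw [Finset.sum_comm]
        simp_rw [Finset.mul_sum]
    _ ≤ ∑ i, c i * ∑' k, a k ^ p :=
        Finset.sum_le_sum fun i _ => mul_le_mul_of_nonneg_left (hshift i) (hc0 i)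
    _ = ∑' k, a k ^ p := by rw [← Finset.sum_mul, hc1, one_mul]

/-! ### From sums of p-th powers to norms -/

theorem exists_normA_expPhase_bounds (hm : 1 ≤ m) {ν : ℕ} {α : ℝ} (hα₀ : 0 ≤ α) (hα₁ : α ≤ 1)
    {φ : EuclideanSpace ℝ (Fin m) → ℝ} (hφ : MemC ν α φ) (hgrad : NondegenerateGradient φ)
    (hν : 2 ≤ (ν : ℝ) + α) {p : ℝ} (hp1 : 1 ≤ p) (hp2 : p < 2)
    (hps : (m : ℝ) * (1 / p - 1 / 2) < (ν : ℝ) + α) :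
    ∃ c₁ c₂ L : ℝ, 0 < c₁ ∧ 0 < c₂ ∧ ∀ lam : ℝ, L ≤ |lam| →
      MemA p (expPhase φ lam) ∧
      c₁ * |lam| ^ ((m : ℝ) * (1 / p - 1 / 2)) ≤ normA p (expPhase φ lam) ∧
      normA p (expPhase φ lam) ≤ c₂ * |lam| ^ ((m : ℝ) * (1 / p - 1 / 2)) := by
  have hp0 : 0 < p := by linarith
  have hν1 : 1 ≤ ν := by
    have : (1 : ℝ) ≤ ν := by linarith
    exact_mod_cast this
  have hexp : (m : ℝ) * (1 - p / 2) = m * (1 / p - 1 / 2) * p := by field_simp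
  obtain ⟨C, hC0, hC⟩ := exists_summable_expPhase_and_tsum_le hν1 hα₀ hα₁ hφ hp0 hp2.le
    (by rw [hexp]; exact mul_lt_mul_of_pos_right hps hp0)
  obtain ⟨c, hc0, hc⟩ := exists_le_tsum_expPhase hm hα₁ hφ hgrad hν hp1
  refine ⟨c ^ (1 / p), C ^ (1 / p), 1, by positivity, by positivity, fun lam hlam => ?_⟩
  obtain ⟨hsum, hup⟩ := hC lam hlam
  have hlow := hc lam hlam hsum
  have hroot : ∀ x : ℝ, 0 ≤ x → (x * |lam| ^ ((m : ℝ) * (1 - p / 2))) ^ (1 / p)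
      = x ^ (1 / p) * |lam| ^ ((m : ℝ) * (1 / p - 1 / 2)) := by
    intro x hx
    rw [Real.mul_rpow hx (by positivity), ← Real.rpow_mul (abs_nonneg _), hexp]
    congr 2
    field_simp
  have hcont := continuous_expPhase hφ.2.1.continuous lam
  have h0 : 0 ≤ ∑' k : Fin m → ℤ, ‖fourierCoefficient (expPhase φ lam) k‖ ^ p :=
    tsum_nonneg fun k => by positivity
  refine ⟨⟨hφ.1.expPhase lam, integrableOn_cube hcont, fun _ => hcont, hsum⟩, ?_, ?_⟩
  · rw [← hroot c hc0.le]
    exact Real.rpow_le_rpow (by positivity) hlow (by positivity)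
  · rw [← hroot C hC0.le]
    exact Real.rpow_le_rpow h0 hup (by positivity)

end TorusA

theorem theorem4 (m : ℕ) (hm : 1 ≤ m) (ν : ℕ) (α : ℝ) (hα₀ : 0 ≤ α) (hα₁ : α ≤ 1)
    (φ : EuclideanSpace ℝ (Fin m) → ℝ) (hφ : TorusA.MemC ν α φ)
    (hgrad : TorusA.NondegenerateGradient φ) (hν : 2 ≤ (ν : ℝ) + α) :
    (∀ p : ℝ, 1 ≤ p → p < 2 → (m : ℝ) * (1 / p - 1 / 2) < (ν : ℝ) + α →
      ∃ c₁ c₂ L : ℝ, 0 < c₁ ∧ 0 < c₂ ∧ ∀ lam : ℝ, L ≤ |lam| →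
        TorusA.MemA p (TorusA.expPhase φ lam) ∧
        c₁ * |lam| ^ ((m : ℝ) * (1 / p - 1 / 2)) ≤ TorusA.normA p (TorusA.expPhase φ lam) ∧
        TorusA.normA p (TorusA.expPhase φ lam) ≤ c₂ * |lam| ^ ((m : ℝ) * (1 / p - 1 / 2))) ∧
    ((m : ℝ) / 2 < (ν : ℝ) + α →
      ∃ c₁ c₂ L : ℝ, 0 < c₁ ∧ 0 < c₂ ∧ ∀ lam : ℝ, L ≤ |lam| →
        TorusA.MemA 1 (TorusA.expPhase φ lam) ∧
        c₁ * |lam| ^ ((m : ℝ) / 2) ≤ TorusA.normA 1 (TorusA.expPhase φ lam) ∧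
        TorusA.normA 1 (TorusA.expPhase φ lam) ≤ c₂ * |lam| ^ ((m : ℝ) / 2)) := by
  refine ⟨fun p hp1 hp2 hps =>
    TorusA.exists_normA_expPhase_bounds hm hα₀ hα₁ hφ hgrad hν hp1 hp2 hps, fun hs => ?_⟩
  have he : (m : ℝ) * (1 / 1 - 1 / 2) = m / 2 := by ring
  have h := TorusA.exists_normA_expPhase_bounds hm hα₀ hα₁ hφ hgrad hν le_rfl one_lt_two
    (by rwa [he])
  rwa [he] at h
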